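/- **Setting.** Let $n\ge 2$ and let $S_n$ be the group of bijections of $\{1,\dots,n\}$ under composition, with the adjacent transpositions $s_i=(i,\,i+1)$, $1\le i\le n-1$. A word in $s_1,\dots,s_{n-1}$ is *reduced* if no shorter word in these letters represents the same element of $S_n$. Put $s_{i,j}=s_is_{i-1}\cdots s_j$ if $j\le i$, and let $s_{i,j}$ be the empty word if $j>i$. Every $u\in S_n$ is represented by exactly one word of the form $s_{1,i_1}s_{2,i_2}\cdots s_{n-1,i_{n-1}}$ with $1\le i_j\le j+1$, its *normal form*; we identify $u$ with this word. For $f\in\mathbb Z[x_1,\dots,x_n]$ let $s_if$ be the result of interchanging $x_i$ and $x_{i+1}$ in $f$, and let $\partial_i f=\dfrac{f-s_if}{x_i-x_{i+1}}$. For a word $w=s_{a_1}\cdots s_{a_p}$ let $\partial_w=\partial_{a_1}\cdots\partial_{a_p}$ (the identity if $p=0$). For $u\in S_n$ let $\partial_u$ be the operator of the normal form of $u$. Let $w_0^n=s_{1,1}s_{2,1}\cdots s_{n-1,1}$, and for $w\in S_n$ let $\mathfrak S_w=\partial_{w^{-1}w_0^n}\bigl(x_1^{n-1}x_2^{n-2}\cdots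 x_{n-1}\bigr)$ be the Schubert polynomial of $w$; in particular $\mathfrak S_{w_0^n}=x_1^{n-1}x_2^{n-2}\cdots x_{n-1}$. Order monomials as follows: $x^k<x^l$ if the total degree of $x^k$ is smaller than that of $x^l$, or if the total degrees agree and $k_j<l_j$ for the largest index $j$ with $k_j\ne l_j$. For $f\neq0$ let $\overline f$ be the largest monomial occurring in $f$; $f$ is *monic* if the coefficient of $\overline f$ is $1$. Let $\deg_{x_t}(x^k)=k_t$, and let $$B_x=\{x_1^{k_1}\cdots x_{n-1}^{k_{n-1}} : k_i\ge 0,\ k_i+i\le n \text{ for } 1\le i\le n-1\}.$$ For $u=s_{1,i_1}\cdots s_{n-1,i_{n-1}}\in S_n$ in normal form and $1\le r\le n-1$, let $q^u_{r,0}=r$. For $l\ge 1$, as long as the set $M^u_{r,l}=\{j : 1\le j<q^u_{r,l-1},\ i_j\le i_r-l\le j\}$ is non-empty, let $q^u_{r,l}=\max M^u_{r,l}$; if $l$ is the first index for which it is empty, let $m^u_r=l-1$. Put $$X^u_j=x_1x_2\cdots x_{i_j-m^u_j-1}\cdot\prod_{1\le k\le m^u_j}x_{1+q^u_{j,k}}\qquad(1\le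 j\le n-1),$$ where the first factor is $1$ if $i_j-m_j^u-1=0$. **Theorem.** Let $n\ge 2$. (i) For every $u\in S_n$ the polynomial $\partial_u\mathfrak S_{w_0^n}$ lies in $\mathbb Z[x_1,\dots,x_{n-1}]$, is monic, and $$\overline{\partial_u\mathfrak S_{w_0^n}}=X^u_{n-1}\cdots X^u_1 .$$ Moreover, the map $u\mapsto X^u_{n-1}\cdots X^u_1$ is a bijection from $S_n$ onto $B_x$. In particular, $\overline{\partial_u\mathfrak S_{w_0^n}}\ne\overline{\partial_v\mathfrak S_{w_0^n}}$ for $u\ne v$ in $S_n$. (ii) For every $u\in S_n$ and $1\le t\le n-1$, the word $s_tu$ is reduced if and only if $$\deg_{x_t}\bigl(\overline{\partial_u\mathfrak S_{w_0^n}}\bigr)>\deg_{x_{t+1}}\bigl(\overline{\partial_u\mathfrak S_{w_0^n}}\bigr).$$ In this case $\partial_t\bigl(\overline{\partial_u\mathfrak S_{w_0^n}}\bigr)\neq 0$, the operator of the word $s_tu$ and the operator of the normal form of the element $s_tu$ of $S_n$ give the same polynomial $\partial_{s_tu}\mathfrak S_{w_0^n}$, and $$\overline{\partial_{s_tu}\mathfrak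 S_{w_0^n}}=\overline{\partial_t\bigl(\overline{\partial_u\mathfrak S_{w_0^n}}\bigr)} .$$ -/

import Mathlib

namespace SchubertLead

/-! ### The symmetric group and words in the adjacent transpositions -/

/-- The symmetric group `S_n` of all bijections of `{1, …, n}`, realised inside `S_∞` as the group
of those permutations of `ℕ` that fix every number outside `{1, …, n}`.  The multiplication is
composition. -/
abbrev SymGroup (n : ℕ) : Subgroup (Equiv.Perm ℕ) :=
  fixingSubgroup (Equiv.Perm ℕ) (Set.Icc 1 n)ᶜ

/-- The adjacent transposition `s_i = (i, i+1)`. -/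
def adj (i : ℕ) : Equiv.Perm ℕ := Equiv.swap i (i + 1)

/-- The permutation `s_{i_1} s_{i_2} ⋯ s_{i_p}` represented by the word `[i_1, i_2, …, i_p]`. -/
def wordProd (w : List ℕ) : Equiv.Perm ℕ := (w.map adj).prod

/-- `w` is a word in the letters `s_1, …, s_{n-1}`. -/
def IsWord (n : ℕ) (w : List ℕ) : Prop := ∀ i ∈ w, 1 ≤ i ∧ i ≤ n - 1

/-- `w` is a reduced word of `S_n`: no word in `s_1, …, s_{n-1}` that represents the same
permutation is shorter. -/
def IsReducedWord (n : ℕ) (w : List ℕ) : Prop :=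
  IsWord n w ∧ ∀ v, IsWord n v → wordProd v = wordProd w → w.length ≤ v.length

/-- The word `s_{i,j} = s_i s_{i-1} ⋯ s_j`, which is empty when `i < j`. -/
def desc (i j : ℕ) : List ℕ := (List.range' j (i + 1 - j)).reverse

/-- The word `s_{1,i_1} s_{2,i_2} ⋯ s_{n-1,i_{n-1}}`. -/
def codeWord (n : ℕ) (i : ℕ → ℕ) : List ℕ :=
  (List.range' 1 (n - 1)).flatMap fun j => desc j (i j)

/-- The index sequences of normal forms of `S_n`: `1 ≤ i_j ≤ j + 1` for `1 ≤ j ≤ n - 1`.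
For all other `j` the value is fixed to be `j + 1`, so that `s_{j,i_j}` is the empty word. -/
def IsCode (n : ℕ) (i : ℕ → ℕ) : Prop :=
  (∀ j, 1 ≤ i j ∧ i j ≤ j + 1) ∧ ∀ j, n ≤ j → i j = j + 1

lemma mem_sym {n : ℕ} {u : Equiv.Perm ℕ} :
    u ∈ SymGroup n ↔ ∀ k, ¬ (1 ≤ k ∧ k ≤ n) → u k = k := by
  simp [SymGroup, mem_fixingSubgroup_iff]

lemma adj_mem {n i : ℕ} (h : 1 ≤ i ∧ i ≤ n - 1) : adj i ∈ SymGroup n := by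
  rw [mem_sym]
  intro k hk
  exact Equiv.swap_apply_of_ne_of_ne (by omega) (by omega)

lemma wordProd_append (v w : List ℕ) : wordProd (v ++ w) = wordProd v * wordProd w := by
  simp [wordProd]

lemma wordProd_mem {n : ℕ} {w : List ℕ} (h : IsWord n w) : wordProd w ∈ SymGroup n := by
  apply Subgroup.list_prod_mem
  intro x hx
  obtain ⟨i, hi, rfl⟩ := List.mem_map.1 hx
  exact adj_mem (h i hi)

lemma isWord_desc {n i j : ℕ} (hj : 1 ≤ j) (hi : i ≤ n - 1) : IsWord n (desc i j) := by
  intro k hk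
  simp only [desc, List.mem_reverse, List.mem_range'_1] at hk
  omega

lemma isWord_codeWord {n : ℕ} {i : ℕ → ℕ} (h : ∀ j, 1 ≤ i j ∧ i j ≤ j + 1) :
    IsWord n (codeWord n i) := by
  intro k hk
  simp only [codeWord, List.mem_flatMap, List.mem_range'_1] at hk
  obtain ⟨j, hj, hk⟩ := hk
  exact isWord_desc (h j).1 (by omega) k hk

lemma codeWord_succ {n : ℕ} (hn : 1 ≤ n) (i : ℕ → ℕ) :
    codeWord (n + 1) i = codeWord n i ++ desc n (i n) := by
  obtain ⟨m, rfl⟩ : ∃ m, n = m + 1 := ⟨n - 1, by omega⟩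
  simp only [codeWord, Nat.add_sub_cancel, List.range'_1_concat, List.flatMap_append]
  simp [Nat.add_comm]

lemma codeWord_congr {n : ℕ} {i i' : ℕ → ℕ} (h : ∀ j < n, i j = i' j) :
    codeWord n i = codeWord n i' := by
  unfold codeWord
  rw [List.flatMap_congr]
  intro j hj
  rw [List.mem_range'_1] at hj
  rw [h j (by omega)]

lemma wordProd_desc_apply (n : ℕ) : ∀ (d a : ℕ), a + d = n + 1 → wordProd (desc n a) a = n + 1 := by
  intro d
  induction d with
  | zero =>
    intro a ha
    have : n + 1 - a = 0 := by omega
    simp only [desc, this, wordProd]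
    simpa using ha
  | succ d ih =>
    intro a ha
    have h1 : n + 1 - a = d + 1 := by omega
    have h2 : n + 1 - (a + 1) = d := by omega
    have : desc n a = desc n (a + 1) ++ [a] := by
      simp [desc, h1, h2, List.range'_succ]
    rw [this, wordProd_append, Equiv.Perm.mul_apply]
    have : wordProd [a] a = a + 1 := by simp [wordProd, adj]
    rw [this]
    exact ih (a + 1) (by omega)

lemma sym_one {n : ℕ} (hn : n ≤ 1) {u : Equiv.Perm ℕ} (hu : u ∈ SymGroup n) : u = 1 := by
  rw [mem_sym] at hu
  have h : ∀ k, k ≠ 1 → u k = k := fun k hk => hu k (by omega)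
  ext k
  by_cases hk : k = 1
  · subst hk
    by_contra h1
    exact h1 (u.injective (h _ h1))
  · simpa using h k hk

lemma codeWord_one {n : ℕ} (hn : n ≤ 1) (i : ℕ → ℕ) : codeWord n i = [] := by
  have : n - 1 = 0 := by omega
  simp [codeWord, this]

lemma exists_code : ∀ (n : ℕ) (u : Equiv.Perm ℕ), u ∈ SymGroup n →
    ∃ i, IsCode n i ∧ wordProd (codeWord n i) = u := by
  intro n
  induction n with
  | zero =>
    intro u hu
    refine ⟨fun j => j + 1, ⟨fun j => ⟨Nat.succ_pos j, le_rfl⟩, fun j _ => rfl⟩, ?_⟩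
    rw [sym_one (by omega) hu, codeWord_one (by omega)]
    rfl
  | succ n ih =>
    intro u hu
    by_cases hn : n = 0
    · refine ⟨fun j => j + 1, ⟨fun j => ⟨Nat.succ_pos j, le_rfl⟩, fun j _ => rfl⟩, ?_⟩
      rw [sym_one (by omega) hu, codeWord_one (by omega)]
      rfl
    set a := u⁻¹ (n + 1) with ha
    have hua : u a = n + 1 := by simp [ha]
    have har : 1 ≤ a ∧ a ≤ n + 1 := by
      by_contra h
      have := mem_sym.1 hu a h
      omega
    set D := wordProd (desc n a) with hD
    have hDa : D a = n + 1 := wordProd_desc_apply n (n + 1 - a) a (by omega)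
    have hDm : D ∈ SymGroup (n + 1) := wordProd_mem (isWord_desc har.1 (by omega))
    have hv : u * D⁻¹ ∈ SymGroup n := by
      have h1 := mem_sym.1 ((SymGroup (n + 1)).mul_mem hu ((SymGroup (n + 1)).inv_mem hDm))
      rw [mem_sym]
      intro k hk
      by_cases hk' : k = n + 1
      · subst hk'
        have hDi : D⁻¹ (n + 1) = a := by rw [Equiv.Perm.inv_eq_iff_eq, hDa]
        rw [Equiv.Perm.mul_apply, hDi, hua]
      · exact h1 k (by omega)
    obtain ⟨i, hi, hw⟩ := ih _ hv
    refine ⟨Function.update i n a, ⟨fun j => ?_, fun j hj => ?_⟩, ?_⟩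
    · by_cases h : j = n
      · subst h
        simpa using har
      · simpa [h] using hi.1 j
    · rw [Function.update_of_ne (by omega)]
      exact hi.2 j (by omega)
    · rw [codeWord_succ (by omega), wordProd_append, Function.update_self,
        codeWord_congr (i' := i) (fun j hj => Function.update_of_ne (by omega) _ _), hw, ← hD]
      simp

lemma code_unique : ∀ (n : ℕ) (i i' : ℕ → ℕ), (∀ j, 1 ≤ i j ∧ i j ≤ j + 1) →
    (∀ j, 1 ≤ i' j ∧ i' j ≤ j + 1) → wordProd (codeWord n i) = wordProd (codeWord n i') →
    ∀ j < n, i j = i' j := by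
  intro n
  induction n with
  | zero => intro i i' _ _ _ j hj; omega
  | succ n ih =>
    intro i i' hi hi' h j hj
    by_cases hn : n = 0
    · have h1 := hi j
      have h2 := hi' j
      omega
    have key : ∀ c : ℕ → ℕ, (∀ j, 1 ≤ c j ∧ c j ≤ j + 1) →
        wordProd (codeWord (n + 1) c) (c n) = n + 1 := by
      intro c hc
      rw [codeWord_succ (by omega), wordProd_append, Equiv.Perm.mul_apply,
        wordProd_desc_apply n (n + 1 - c n) (c n) (by have := hc n; omega)]
      exact mem_sym.1 (wordProd_mem (isWord_codeWord hc)) _ (by omega)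
    have hin : i n = i' n := by
      apply (wordProd (codeWord (n + 1) i)).injective
      rw [key i hi, h, key i' hi']
    by_cases hjn : j = n
    · rw [hjn, hin]
    · refine ih i i' hi hi' ?_ j (by omega)
      rw [codeWord_succ (by omega), codeWord_succ (by omega), wordProd_append, wordProd_append,
        hin] at h
      exact mul_right_cancel h

/-- Every element of `S_n` has exactly one normal form `s_{1,i_1} s_{2,i_2} ⋯ s_{n-1,i_{n-1}}`. -/
theorem existsUnique_code {n : ℕ} (u : SymGroup n) :
    ∃! i, IsCode n i ∧ wordProd (codeWord n i) = (u : Equiv.Perm ℕ) := by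
  obtain ⟨i, hi, hw⟩ := exists_code n u u.2
  refine ⟨i, ⟨hi, hw⟩, ?_⟩
  rintro i' ⟨hi', hw'⟩
  funext j
  by_cases hj : j < n
  · exact code_unique n i' i hi'.1 hi.1 (hw'.trans hw.symm) j hj
  · rw [hi.2 j (by omega), hi'.2 j (by omega)]

/-- The indices `i_1, …, i_{n-1}` of the normal form `s_{1,i_1} ⋯ s_{n-1,i_{n-1}}` of `u ∈ S_n`. -/
noncomputable def code {n : ℕ} (u : SymGroup n) : ℕ → ℕ := (existsUnique_code u).choose

lemma code_spec {n : ℕ} (u : SymGroup n) :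
    IsCode n (code u) ∧ wordProd (codeWord n (code u)) = (u : Equiv.Perm ℕ) :=
  (existsUnique_code u).choose_spec.1

/-- The normal form of `u ∈ S_n`, a word in `s_1, …, s_{n-1}`. -/
noncomputable def normalWord {n : ℕ} (u : SymGroup n) : List ℕ := codeWord n (code u)

/-- `w_0^n = s_{1,1} s_{2,1} ⋯ s_{n-1,1}`, as an element of `S_n`. -/
def w0 (n : ℕ) : SymGroup n :=
  ⟨wordProd (codeWord n fun _ => 1), wordProd_mem (isWord_codeWord fun j => by omega)⟩

/-! ### Divided differences and Schubert polynomials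

Polynomials live in `ℤ[x_0, x_1, x_2, …]`, which contains `ℤ[x_1, …, x_n]` for every `n`;
the variable `x_0` is never used. -/

/-- `s_i f`: the result of interchanging `x_i` and `x_{i+1}` in `f`. -/
noncomputable def swapVars (i : ℕ) (f : MvPolynomial ℕ ℤ) : MvPolynomial ℕ ℤ :=
  MvPolynomial.rename (adj i) f

lemma dvd_sub_swapVars (i : ℕ) (f : MvPolynomial ℕ ℤ) :
    (MvPolynomial.X i - MvPolynomial.X (i + 1) : MvPolynomial ℕ ℤ) ∣ f - swapVars i f := by
  induction f using MvPolynomial.induction_on with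
  | C a => simp [swapVars]
  | add p q hp hq =>
    have : p + q - swapVars i (p + q) = (p - swapVars i p) + (q - swapVars i q) := by
      simp only [swapVars, map_add]
      ring
    rw [this]
    exact dvd_add hp hq
  | mul_X p k hp =>
    have h : p * MvPolynomial.X k - swapVars i (p * MvPolynomial.X k) =
        (p - swapVars i p) * MvPolynomial.X k +
          swapVars i p * (MvPolynomial.X k - MvPolynomial.X (adj i k)) := by
      simp only [swapVars, map_mul, MvPolynomial.rename_X]
      ring
    rw [h]
    refine dvd_add (hp.mul_right _) (Dvd.dvd.mul_left ?_ _)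
    by_cases h1 : k = i
    · subst h1
      simp [adj]
    by_cases h2 : k = i + 1
    · subst h2
      simp only [adj, Equiv.swap_apply_right]
      exact ⟨-1, by ring⟩
    · rw [adj, Equiv.swap_apply_of_ne_of_ne h1 h2]
      simp

/-- The divided difference operator `∂_i f = (f - s_i f) / (x_i - x_{i+1})`, i.e. the polynomial
whose product with `x_i - x_{i+1}` is `f - s_i f`. -/
noncomputable def divDiff (i : ℕ) (f : MvPolynomial ℕ ℤ) : MvPolynomial ℕ ℤ :=
  (dvd_sub_swapVars i f).choose

lemma divDiff_spec (i : ℕ) (f : MvPolynomial ℕ ℤ) :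
    f - swapVars i f = (MvPolynomial.X i - MvPolynomial.X (i + 1)) * divDiff i f :=
  (dvd_sub_swapVars i f).choose_spec

/-- `∂_w = ∂_{i_1} ∂_{i_2} ⋯ ∂_{i_p}` for a word `w = s_{i_1} s_{i_2} ⋯ s_{i_p}`; it is the identity
for the empty word. -/
noncomputable def divDiffWord (w : List ℕ) (f : MvPolynomial ℕ ℤ) : MvPolynomial ℕ ℤ :=
  w.foldr divDiff f

/-- `∂_u` for `u ∈ S_n`: the operator `∂_w` for the normal form `w` of `u`. -/
noncomputable def divDiffPerm {n : ℕ} (u : SymGroup n) (f : MvPolynomial ℕ ℤ) : MvPolynomial ℕ ℤ :=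
  divDiffWord (normalWord u) f

/-- The Schubert polynomial `𝔖_w = ∂_{w⁻¹ w_0^n} (x_1^{n-1} x_2^{n-2} ⋯ x_{n-1})` of `w ∈ S_n`. -/
noncomputable def schubert {n : ℕ} (w : SymGroup n) : MvPolynomial ℕ ℤ :=
  divDiffPerm (w⁻¹ * w0 n) (∏ k ∈ Finset.Icc 1 (n - 1), MvPolynomial.X k ^ (n - k))

/-! ### The monomial order

Monomials `x^k` are given by their exponents `k : ℕ →₀ ℕ`. -/

/-- The monomial order: compare the total degree first; if the total degrees agree, look at the
*largest* index where the exponents differ, and the monomial with the larger exponent there is the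
larger one.  It is the degree-lexicographic order for the reversed order of the variables. -/
noncomputable def ord : MonomialOrder ℕ where
  syn := DegLex (ℕᵒᵈ →₀ ℕ)
  toSyn := (Finsupp.domCongr OrderDual.toDual).trans
    { toEquiv := toDegLex, map_add' := toDegLex_add }
  toSyn_monotone a b h := MonomialOrder.degLex.toSyn_monotone
    (show Finsupp.domCongr OrderDual.toDual a ≤ Finsupp.domCongr OrderDual.toDual b from
      fun i => by simpa using h (OrderDual.ofDual i))

/-- The leading monomial of a (nonzero) polynomial, given by its exponents. -/
noncomputable def lm (f : MvPolynomial ℕ ℤ) : ℕ →₀ ℕ := ord.degree f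

/-- `B_x`: the monomials `x_1^{k_1} ⋯ x_{n-1}^{k_{n-1}}` with `k_i + i ≤ n` for `1 ≤ i ≤ n - 1`. -/
def Bx (n : ℕ) : Set (ℕ →₀ ℕ) :=
  {k | (∀ i, 1 ≤ i ∧ i ≤ n - 1 → k i + i ≤ n) ∧ ∀ i, ¬ (1 ≤ i ∧ i ≤ n - 1) → k i = 0}

/-! ### The monomials `X_j^u`

Here `i : ℕ → ℕ` is the index sequence of the normal form of `u`; all its values are positive. -/

/-- The set `{j ∣ 1 ≤ j < p, i_r - l ∈ [i_j, j]}`.  As `i_j ≥ 1`, the truncated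
subtraction makes no difference. -/
def mSet (i : ℕ → ℕ) (r l p : ℕ) : Finset ℕ :=
  (Finset.Ico 1 p).filter fun j => i j ≤ i r - l ∧ i r - l ≤ j

/-- `q_{r,0} = r` and `q_{r,l} = max {j ∣ 1 ≤ j < q_{r,l-1}, i_r - l ∈ [i_j, j]}` for `l ≥ 1`; the
value is `0` from the first `l` on for which this set is empty. -/
def qIdx (i : ℕ → ℕ) (r : ℕ) : ℕ → ℕ
  | 0 => r
  | l + 1 => (mSet i r (l + 1) (qIdx i r l)).sup id

/-- `m_r`: the least `l` such that `{j ∣ 1 ≤ j < q_{r,l}, i_r - (l+1) ∈ [i_j, j]}` is empty. -/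
noncomputable def mIdx (i : ℕ → ℕ) (r : ℕ) : ℕ := sInf {l | mSet i r (l + 1) (qIdx i r l) = ∅}

/-- The exponents of `X_j^u = x_1 x_2 ⋯ x_{i_j - m_j - 1} · ∏_{1 ≤ k ≤ m_j} x_{1 + q_{j,k}}`. -/
noncomputable def monX (i : ℕ → ℕ) (j : ℕ) : ℕ →₀ ℕ :=
  (∑ a ∈ Finset.Icc 1 (i j - mIdx i j - 1), Finsupp.single a 1) +
    (∑ k ∈ Finset.Icc 1 (mIdx i j), Finsupp.single (1 + qIdx i j k) 1)

/-- The exponents of `X_{n-1}^u ⋯ X_2^u X_1^u`. -/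
noncomputable def prodX {n : ℕ} (u : SymGroup n) : ℕ →₀ ℕ :=
  ∑ j ∈ Finset.Icc 1 (n - 1), monX (code u) j

end SchubertLead

open SchubertLead

namespace SchubertLead

/-! ### Divided differences -/

/-! Let `i` be the index sequence of `u`. If `i_{t-1} < i_t`, the sequence of `s_t u` arises by
replacing the pair `(i_{t-1}, i_t)` by `(i_t - 1, i_{t-1})` (`step`). Only braid relations enter, so
one lemma, `BraidRelations.codeWord_step`, serves permutations and divided differences alike.
Otherwise `step` can be inverted, and this yields the criterion for `s_t u` to be reduced.

The indices `q` and `m` disappear once `X_r` is recognised as the product of the `x_{v(a)}` with `1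
≤ a < i_r`, where `v = s_{1,i_1} ⋯ s_{r-1,i_{r-1}}` (`monX_eq_imageExp`). Passing from `u` to `s_t
u` then swaps `x_t` and `x_{t+1}` in the product of the `X_r` and divides by `x_{t+1}`
(`codeExp_step`). This is what `∂_t` does to the leading term of a monomial with `k_t > k_{t+1}`.

The leading monomial of `∂_u 𝔖_{w_0}` cannot be found by following single operators `∂_t`: a smaller
monomial may have the larger image. The induction is on `n` instead. Let `t` be the last index with
an empty factor `s_{t,i_t}`, index `0` included. Then `u = s_{t+1} ⋯ s_N u'` in `S_{N+1}` with `u'`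
in `S_N`, and the polynomial of `u` is `x_1 ⋯ x_t · π_{t+1} ⋯ π_N` applied to that of `u'`, where
`π_s f = ∂_s (x_s f)` (`codePoly_insertCode`). On polynomials in `x_1, …, x_N` this chain acts on
leading monomials by the strictly monotone relabelling that skips `x_{t+1}` (`HasLead.isoChain`).
The exponents of the `X_r` obey the same recursion (`codeExp_insertCode`), and so does `B_x`, with
`x_{t+1}` the first variable that is absent; this gives both the leading monomials and the
bijection. -/

open MvPolynomial in
lemma X_sub_X_succ_ne_zero (t : ℕ) : (X t - X (t + 1) : MvPolynomial ℕ ℤ) ≠ 0 := by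
  rw [sub_ne_zero]
  intro h
  have := X_injective (R := ℤ) h
  omega

lemma divDiff_eq_of_mul_eq {t : ℕ} {f g : MvPolynomial ℕ ℤ}
    (h : (MvPolynomial.X t - MvPolynomial.X (t + 1)) * g = f - swapVars t f) :
    divDiff t f = g := by
  rw [divDiff_spec] at h
  exact (mul_left_cancel₀ (X_sub_X_succ_ne_zero t) h).symm

lemma swapVars_add (t : ℕ) (f g : MvPolynomial ℕ ℤ) :
    swapVars t (f + g) = swapVars t f + swapVars t g := map_add _ f g

lemma swapVars_sub (t : ℕ) (f g : MvPolynomial ℕ ℤ) :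
    swapVars t (f - g) = swapVars t f - swapVars t g := map_sub _ f g

lemma swapVars_mul (t : ℕ) (f g : MvPolynomial ℕ ℤ) :
    swapVars t (f * g) = swapVars t f * swapVars t g := map_mul _ f g

lemma swapVars_X (t k : ℕ) :
    swapVars t (MvPolynomial.X k) = MvPolynomial.X (adj t k) := MvPolynomial.rename_X _ _

lemma adj_left (t : ℕ) : adj t t = t + 1 := Equiv.swap_apply_left _ _

lemma adj_right (t : ℕ) : adj t (t + 1) = t := Equiv.swap_apply_right _ _

lemma adj_of_ne {t k : ℕ} (h : k ≠ t) (h' : k ≠ t + 1) : adj t k = k :=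
  Equiv.swap_apply_of_ne_of_ne h h'

lemma adj_mul_self (t : ℕ) : adj t * adj t = 1 := Equiv.swap_mul_self _ _

lemma adj_adj (t k : ℕ) : adj t (adj t k) = k := Equiv.swap_apply_self _ _ _

lemma adj_comm {i j : ℕ} (h : i + 2 ≤ j) : adj i * adj j = adj j * adj i := by
  ext k
  simp only [Equiv.Perm.mul_apply, adj, Equiv.swap_apply_def]
  split_ifs <;> omega

lemma adj_braid (i : ℕ) : adj i * adj (i + 1) * adj i = adj (i + 1) * adj i * adj (i + 1) := by
  ext k
  simp only [Equiv.Perm.mul_apply, adj, Equiv.swap_apply_def]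
  split_ifs <;> omega

lemma swapVars_swapVars (i j : ℕ) (f : MvPolynomial ℕ ℤ) :
    swapVars i (swapVars j f) = MvPolynomial.rename (adj i * adj j) f := by
  simp only [swapVars, MvPolynomial.rename_rename]
  rfl

lemma swapVars_self (t : ℕ) (f : MvPolynomial ℕ ℤ) : swapVars t (swapVars t f) = f := by
  rw [swapVars_swapVars, adj_mul_self]
  exact MvPolynomial.rename_id_apply f

lemma swapVars_comm {i j : ℕ} (h : i + 2 ≤ j) (f : MvPolynomial ℕ ℤ) :
    swapVars i (swapVars j f) = swapVars j (swapVars i f) := by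
  rw [swapVars_swapVars, swapVars_swapVars, adj_comm h]

lemma swapVars_braid (i : ℕ) (f : MvPolynomial ℕ ℤ) :
    swapVars i (swapVars (i + 1) (swapVars i f)) =
      swapVars (i + 1) (swapVars i (swapVars (i + 1) f)) := by
  have := congrArg (fun p : Equiv.Perm ℕ => MvPolynomial.rename p f) (adj_braid i)
  simp only [swapVars, MvPolynomial.rename_rename]
  exact this

/-- The divided difference as a linear map. -/
noncomputable def divDiffLin (t : ℕ) : MvPolynomial ℕ ℤ →ₗ[ℤ] MvPolynomial ℕ ℤ where
  toFun := divDiff t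
  map_add' f g := by
    apply divDiff_eq_of_mul_eq
    rw [mul_add, ← divDiff_spec, ← divDiff_spec, swapVars_add]
    ring
  map_smul' c f := by
    apply divDiff_eq_of_mul_eq
    rw [RingHom.id_apply, mul_smul_comm, ← divDiff_spec, smul_sub, swapVars, swapVars, map_smul]

lemma divDiff_smul (t : ℕ) (c : ℤ) (f : MvPolynomial ℕ ℤ) :
    divDiff t (c • f) = c • divDiff t f := (divDiffLin t).map_smul c f

lemma divDiff_sum {ι : Type*} (t : ℕ) (s : Finset ι) (f : ι → MvPolynomial ℕ ℤ) :
    divDiff t (∑ k ∈ s, f k) = ∑ k ∈ s, divDiff t (f k) := map_sum (divDiffLin t) f s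

lemma divDiff_mul_left {t : ℕ} {g : MvPolynomial ℕ ℤ} (hg : swapVars t g = g)
    (f : MvPolynomial ℕ ℤ) : divDiff t (g * f) = g * divDiff t f := by
  apply divDiff_eq_of_mul_eq
  rw [swapVars_mul, hg, mul_left_comm, ← divDiff_spec, mul_sub]

lemma swapVars_divDiff (t : ℕ) (f : MvPolynomial ℕ ℤ) :
    swapVars t (divDiff t f) = divDiff t f := by
  apply mul_left_cancel₀ (X_sub_X_succ_ne_zero t)
  have h := congrArg (swapVars t) (divDiff_spec t f)
  rw [swapVars_sub, swapVars_self, swapVars_mul, swapVars_sub, swapVars_X, swapVars_X, adj_left,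
    adj_right] at h
  have h' := divDiff_spec t f
  linear_combination h + h'

lemma divDiff_swapVars (t : ℕ) (f : MvPolynomial ℕ ℤ) :
    divDiff t (swapVars t f) = -divDiff t f := by
  apply divDiff_eq_of_mul_eq
  rw [swapVars_self, mul_neg, ← divDiff_spec]
  ring

lemma divDiff_comm {i j : ℕ} (h : i + 2 ≤ j) (f : MvPolynomial ℕ ℤ) :
    divDiff i (divDiff j f) = divDiff j (divDiff i f) := by
  have hi : swapVars j (MvPolynomial.X i - MvPolynomial.X (i + 1)) =
      MvPolynomial.X i - MvPolynomial.X (i + 1) := by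
    rw [swapVars_sub, swapVars_X, swapVars_X, adj_of_ne (by omega) (by omega),
      adj_of_ne (by omega) (by omega)]
  have hj : swapVars i (MvPolynomial.X j - MvPolynomial.X (j + 1)) =
      MvPolynomial.X j - MvPolynomial.X (j + 1) := by
    rw [swapVars_sub, swapVars_X, swapVars_X, adj_of_ne (by omega) (by omega),
      adj_of_ne (by omega) (by omega)]
  have h1 := congrArg (swapVars i) (divDiff_spec j f)
  have h2 := congrArg (swapVars j) (divDiff_spec i f)
  rw [swapVars_mul, hj, swapVars_sub] at h1
  rw [swapVars_mul, hi, swapVars_sub] at h2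
  apply divDiff_eq_of_mul_eq
  apply mul_left_cancel₀ (X_sub_X_succ_ne_zero j)
  rw [mul_left_comm, ← divDiff_spec]
  linear_combination divDiff_spec j f - h1 - divDiff_spec i f + h2 - swapVars_comm h f

/-- After multiplication by the product of the three differences of `x_i`, `x_{i+1}`, `x_{i+2}`,
both sides become the alternating sum of `f` over the group generated by `s_i` and `s_{i+1}`. -/
lemma divDiff_braid (i : ℕ) (f : MvPolynomial ℕ ℤ) :
    divDiff i (divDiff (i + 1) (divDiff i f)) =
      divDiff (i + 1) (divDiff i (divDiff (i + 1) f)) := by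
  set a : MvPolynomial ℕ ℤ := MvPolynomial.X i - MvPolynomial.X (i + 1) with ha
  set b : MvPolynomial ℕ ℤ := MvPolynomial.X (i + 1) - MvPolynomial.X (i + 1 + 1) with hb
  have e1 : adj i (i + 1 + 1) = i + 1 + 1 := adj_of_ne (by omega) (by omega)
  have e2 : adj (i + 1) i = i := adj_of_ne (by omega) (by omega)
  have sab : swapVars i b = a + b := by
    rw [hb, swapVars_sub, swapVars_X, swapVars_X, adj_right, e1, ha]
    ring
  have sba : swapVars (i + 1) a = a + b := by
    rw [ha, swapVars_sub, swapVars_X, swapVars_X, adj_left, e2, hb]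
    ring
  have saa : swapVars i a = -a := by
    rw [ha, swapVars_sub, swapVars_X, swapVars_X, adj_right, adj_left]
    ring
  have sbb : swapVars (i + 1) b = -b := by
    rw [hb, swapVars_sub, swapVars_X, swapVars_X, adj_right, adj_left]
    ring
  have hab : a + b ≠ 0 := by
    rw [ha, hb, sub_add_sub_cancel, sub_ne_zero]
    intro h
    have := MvPolynomial.X_injective (R := ℤ) h
    omega
  have hne : a * b * (a + b) ≠ 0 :=
    mul_ne_zero (mul_ne_zero (X_sub_X_succ_ne_zero i) (X_sub_X_succ_ne_zero (i + 1))) hab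
  apply mul_left_cancel₀ hne
  have left : a * b * (a + b) * divDiff i (divDiff (i + 1) (divDiff i f)) =
      f - swapVars i f - swapVars (i + 1) f + swapVars i (swapVars (i + 1) f) +
        swapVars (i + 1) (swapVars i f) - swapVars i (swapVars (i + 1) (swapVars i f)) := by
    have h1 := divDiff_spec i f
    have h2 := divDiff_spec (i + 1) (divDiff i f)
    have h3 := divDiff_spec i (divDiff (i + 1) (divDiff i f))
    have h4 := congrArg (swapVars i) h2
    have h5 := congrArg (swapVars (i + 1)) h1
    have h6 := congrArg (swapVars i) h5
    rw [← ha] at h1 h3 h5 h6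
    rw [← hb] at h2 h4
    simp only [swapVars_sub, swapVars_mul, sab, sba, swapVars_divDiff, swapVars_add, saa] at h4 h5 h6
    linear_combination -b * (a + b) * h3 + b * h4 - (a + b) * h2 - h1 + h5 - h6
  have right : a * b * (a + b) * divDiff (i + 1) (divDiff i (divDiff (i + 1) f)) =
      f - swapVars i f - swapVars (i + 1) f + swapVars i (swapVars (i + 1) f) +
        swapVars (i + 1) (swapVars i f) - swapVars (i + 1) (swapVars i (swapVars (i + 1) f)) := by
    have h1 := divDiff_spec (i + 1) f
    have h2 := divDiff_spec i (divDiff (i + 1) f)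
    have h3 := divDiff_spec (i + 1) (divDiff i (divDiff (i + 1) f))
    have h4 := congrArg (swapVars (i + 1)) h2
    have h5 := congrArg (swapVars i) h1
    have h6 := congrArg (swapVars (i + 1)) h5
    rw [← hb] at h1 h3 h5 h6
    rw [← ha] at h2 h4
    simp only [swapVars_sub, swapVars_mul, sab, sba, swapVars_divDiff, swapVars_add, sbb] at h4 h5 h6
    linear_combination -a * (a + b) * h3 + a * h4 - (a + b) * h2 - h1 + h5 - h6
  rw [left, right, swapVars_braid]

/-! ### Divided differences of monomials -/

lemma swapVars_monomial (t : ℕ) (k : ℕ →₀ ℕ) (c : ℤ) :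
    swapVars t (MvPolynomial.monomial k c) =
      MvPolynomial.monomial (k.mapDomain (adj t)) c := MvPolynomial.rename_monomial _ _ _

lemma mapDomain_adj_apply (t : ℕ) (k : ℕ →₀ ℕ) (s : ℕ) :
    k.mapDomain (adj t) s = k (adj t s) := by
  conv_lhs => rw [← adj_adj t s]
  exact Finsupp.mapDomain_apply (adj t).injective _ _

lemma mapDomain_adj_eq_self {t : ℕ} {k : ℕ →₀ ℕ} (h : k t = k (t + 1)) :
    k.mapDomain (adj t) = k := by
  ext s
  rw [mapDomain_adj_apply]
  by_cases h1 : s = t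
  · rw [h1, adj_left, h]
  by_cases h2 : s = t + 1
  · rw [h2, adj_right, h]
  rw [adj_of_ne h1 h2]

/-- The symmetric factor `x^r` passes through `∂_t`; what remains is a geometric sum. -/
lemma divDiff_monomial_add_single {t : ℕ} {r : ℕ →₀ ℕ} (h : r t = r (t + 1)) (a : ℕ) :
    divDiff t (MvPolynomial.monomial (r + Finsupp.single t a) 1) =
      ∑ p ∈ Finset.range a, MvPolynomial.monomial
        (r + Finsupp.single t p + Finsupp.single (t + 1) (a - 1 - p)) 1 := by
  have h1 : ∀ k : ℕ →₀ ℕ, ∀ s p, (MvPolynomial.monomial (k + Finsupp.single s p) (1 : ℤ)) =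
      MvPolynomial.monomial k 1 * MvPolynomial.X s ^ p := by
    intro k s p
    rw [MvPolynomial.X_pow_eq_monomial, MvPolynomial.monomial_mul, one_mul]
  have hr : swapVars t (MvPolynomial.monomial r 1) = MvPolynomial.monomial r 1 := by
    rw [swapVars_monomial, mapDomain_adj_eq_self h]
  simp only [h1, mul_assoc]
  rw [divDiff_mul_left hr, ← Finset.mul_sum]
  congr 1
  apply divDiff_eq_of_mul_eq
  rw [(Commute.all _ _).mul_geom_sum₂]
  congr 1
  simp only [swapVars, map_pow, MvPolynomial.rename_X, adj_left]

/-- The exponents that can occur in `∂_t x^k`. -/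
def DivDiffRel (t : ℕ) (k l : ℕ →₀ ℕ) : Prop :=
  l.degree + 1 = k.degree ∧ (∀ s, s ≠ t → s ≠ t + 1 → l s = k s) ∧
    l t < max (k t) (k (t + 1)) ∧ l (t + 1) < max (k t) (k (t + 1))

lemma eq_add_single_of_le {t : ℕ} {k : ℕ →₀ ℕ} (h : k (t + 1) ≤ k t) :
    ∃ r : ℕ →₀ ℕ, r t = r (t + 1) ∧ r (t + 1) = k (t + 1) ∧
      k = r + Finsupp.single t (k t - k (t + 1)) := by
  refine ⟨k - Finsupp.single t (k t - k (t + 1)), ?_, ?_, ?_⟩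
  · simp
    omega
  · simp
  · rw [tsub_add_cancel_of_le]
    rw [Finsupp.single_le_iff]
    omega

lemma divDiffRel_of_mem_support_monomial {t : ℕ} {k l : ℕ →₀ ℕ}
    (hl : l ∈ (divDiff t (MvPolynomial.monomial k (1 : ℤ))).support) : DivDiffRel t k l := by
  have main : ∀ k l : ℕ →₀ ℕ, k (t + 1) ≤ k t →
      l ∈ (divDiff t (MvPolynomial.monomial k (1 : ℤ))).support → DivDiffRel t k l := by
    intro k l hk hl
    obtain ⟨r, hr, hr', hkr⟩ := eq_add_single_of_le hk
    set a := k t - k (t + 1) with ha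
    rw [hkr, divDiff_monomial_add_single hr] at hl
    obtain ⟨p, hp, hl⟩ := Finset.mem_biUnion.1 (MvPolynomial.support_sum hl)
    rw [Finset.mem_range] at hp
    have hl' : l = r + Finsupp.single t p + Finsupp.single (t + 1) (a - 1 - p) := by
      simpa using MvPolynomial.support_monomial_subset hl
    have hkt : k t = r t + a := by rw [hkr]; simp
    refine ⟨?_, fun s h1 h2 => ?_, ?_, ?_⟩
    · rw [hl', hkr]
      simp only [map_add, Finsupp.degree_single]
      omega
    · rw [hl', hkr]
      simp [Ne.symm h1, Ne.symm h2]
    · rw [hl']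
      simp
      omega
    · rw [hl']
      simp
      omega
  rcases le_total (k (t + 1)) (k t) with h | h
  · exact main k l h hl
  -- Swapping the two exponents only changes the sign of the divided difference.
  · have h1 := main (k.mapDomain (adj t)) l
      (by rwa [mapDomain_adj_apply, mapDomain_adj_apply, adj_left, adj_right])
      (by rwa [← swapVars_monomial, divDiff_swapVars, MvPolynomial.support_neg])
    unfold DivDiffRel at h1 ⊢
    rw [Finsupp.degree_mapDomain] at h1
    simp only [mapDomain_adj_apply, adj_left, adj_right] at h1
    refine ⟨h1.1, fun s hs hs' => ?_, by omega, by omega⟩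
    rw [h1.2.1 s hs hs', adj_of_ne hs hs']

lemma divDiff_eq_sum (t : ℕ) (f : MvPolynomial ℕ ℤ) :
    divDiff t f = ∑ k ∈ f.support, f.coeff k • divDiff t (MvPolynomial.monomial k 1) := by
  conv_lhs => rw [f.as_sum]
  rw [divDiff_sum]
  refine Finset.sum_congr rfl fun k _ => ?_
  rw [← divDiff_smul, MvPolynomial.smul_monomial, smul_eq_mul, mul_one]

lemma exists_divDiffRel_of_mem_support {t : ℕ} {f : MvPolynomial ℕ ℤ} {l : ℕ →₀ ℕ}
    (hl : l ∈ (divDiff t f).support) : ∃ k ∈ f.support, DivDiffRel t k l := by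
  rw [divDiff_eq_sum] at hl
  obtain ⟨k, hk, hl⟩ := Finset.mem_biUnion.1 (MvPolynomial.support_sum hl)
  exact ⟨k, hk, divDiffRel_of_mem_support_monomial (MvPolynomial.support_smul hl)⟩

/-! ### The monomial order -/

lemma ord_lt_iff {a b : ℕ →₀ ℕ} : ord.toSyn a < ord.toSyn b ↔ a.degree < b.degree ∨
    a.degree = b.degree ∧ ∃ j, a j < b j ∧ ∀ i, j < i → a i = b i := by
  change toDegLex (Finsupp.domCongr OrderDual.toDual a) <
    toDegLex (Finsupp.domCongr OrderDual.toDual b) ↔ _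
  rw [Finsupp.DegLex.lt_iff]
  have hd : ∀ c : ℕ →₀ ℕ,
      (Finsupp.domCongr (M := ℕ) (OrderDual.toDual (α := ℕ)) c).degree = c.degree := by
    intro c
    simp [Finsupp.domCongr, Finsupp.equivMapDomain_eq_mapDomain, Finsupp.degree_mapDomain]
  simp only [ofDegLex_toDegLex, hd]
  rw [Finsupp.Lex.lt_iff]
  refine or_congr Iff.rfl (and_congr Iff.rfl ?_)
  constructor
  · rintro ⟨j, h1, h2⟩
    exact ⟨OrderDual.ofDual j, h2, fun i hi => h1 (OrderDual.toDual i) hi⟩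
  · rintro ⟨j, h1, h2⟩
    exact ⟨OrderDual.toDual j, fun i hi => h2 (OrderDual.ofDual i) hi, h1⟩

/-- `f` is monic with leading monomial `x^k`. -/
def HasLead (f : MvPolynomial ℕ ℤ) (k : ℕ →₀ ℕ) : Prop :=
  f.coeff k = 1 ∧ ∀ l ∈ f.support, l ≠ k → ord.toSyn l < ord.toSyn k

lemma HasLead.lm_eq {f : MvPolynomial ℕ ℤ} {k : ℕ →₀ ℕ} (h : HasLead f k) : lm f = k := by
  have hk : k ∈ f.support := by rw [MvPolynomial.mem_support_iff, h.1]; exact one_ne_zero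
  by_contra hne
  have h0 : f ≠ 0 := by rintro rfl; simp at hk
  have h1 := h.2 _ (ord.degree_mem_support h0) hne
  exact absurd (ord.le_degree hk) (not_le.2 h1)

lemma HasLead.monic {f : MvPolynomial ℕ ℤ} {k : ℕ →₀ ℕ} (h : HasLead f k) : ord.Monic f := by
  have := h.lm_eq
  rw [lm] at this
  rw [MonomialOrder.Monic, MonomialOrder.leadingCoeff, this, h.1]

lemma hasLead_monomial (k : ℕ →₀ ℕ) : HasLead (MvPolynomial.monomial k 1) k := by
  refine ⟨by simp, fun l hl hne => ?_⟩
  exact absurd (by simpa using MvPolynomial.support_monomial_subset hl) hne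

lemma HasLead.monomial_mul {f : MvPolynomial ℕ ℤ} {k : ℕ →₀ ℕ} (h : HasLead f k) (r : ℕ →₀ ℕ) :
    HasLead (MvPolynomial.monomial r 1 * f) (r + k) := by
  refine ⟨by rw [MvPolynomial.coeff_monomial_mul, h.1, one_mul], fun l hl hne => ?_⟩
  rw [MvPolynomial.mem_support_iff, MvPolynomial.coeff_monomial_mul'] at hl
  split_ifs at hl with hr
  · rw [one_mul, ← MvPolynomial.mem_support_iff] at hl
    have h1 : l = r + (l - r) := (add_tsub_cancel_of_le hr).symm
    rw [h1, map_add, map_add]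
    refine add_lt_add_right (h.2 _ hl ?_) _
    rintro rfl
    exact hne h1
  · exact absurd rfl hl

/-- A monic polynomial plus smaller terms. -/
lemma HasLead.add {f g : MvPolynomial ℕ ℤ} {k : ℕ →₀ ℕ} (h : HasLead f k)
    (hg : ∀ l ∈ g.support, ord.toSyn l < ord.toSyn k) : HasLead (f + g) k := by
  have hk : g.coeff k = 0 := by
    by_contra hne
    exact lt_irrefl _ (hg k (MvPolynomial.mem_support_iff.2 hne))
  refine ⟨by rw [MvPolynomial.coeff_add, h.1, hk, add_zero], fun l hl hne => ?_⟩
  rcases Finset.mem_union.1 (MvPolynomial.support_add hl) with hl | hl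
  · exact h.2 l hl hne
  · exact hg l hl

/-- The effect of `∂_t` on the leading exponents `k` with `k_t > k_{t+1}`. -/
lemma hasLead_divDiff_monomial {t : ℕ} {k k' : ℕ →₀ ℕ} (h : k (t + 1) < k t)
    (h' : k.mapDomain (adj t) = k' + Finsupp.single (t + 1) 1) :
    HasLead (divDiff t (MvPolynomial.monomial k 1)) k' := by
  obtain ⟨r, hr, hr', hkr⟩ := eq_add_single_of_le h.le
  obtain ⟨a, ha⟩ : ∃ a, k t - k (t + 1) = a + 1 := ⟨k t - k (t + 1) - 1, by omega⟩
  rw [ha] at hkr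
  have hk' : k' = r + Finsupp.single (t + 1) a := by
    have h1 : k.mapDomain (adj t) = r + Finsupp.single (t + 1) (a + 1) := by
      rw [hkr, Finsupp.mapDomain_add, mapDomain_adj_eq_self hr, Finsupp.mapDomain_single, adj_left]
    rw [h1, Finsupp.single_add, ← add_assoc] at h'
    exact (add_right_cancel h').symm
  -- The summand `p = 0`, with the whole power on `x_{t+1}`, is split off: it is the largest.
  rw [hkr, divDiff_monomial_add_single hr, Finset.sum_range_succ', add_comm]
  refine HasLead.add ?_ fun l hl => ?_
  · simpa [hk'] using hasLead_monomial k'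
  · obtain ⟨p, hp, hl⟩ := Finset.mem_biUnion.1 (MvPolynomial.support_sum hl)
    rw [Finset.mem_range] at hp
    have hl' : l = r + Finsupp.single t (p + 1) + Finsupp.single (t + 1) (a + 1 - 1 - (p + 1)) := by
      simpa using MvPolynomial.support_monomial_subset hl
    rw [ord_lt_iff, hl', hk']
    right
    refine ⟨?_, t + 1, ?_, fun i hi => ?_⟩
    · simp only [map_add, Finsupp.degree_single]
      omega
    · simp
      omega
    · simp [show t ≠ i by omega, show t + 1 ≠ i by omega]

/-! ### Descending words and braid relations -/

lemma desc_of_lt {i j : ℕ} (h : i < j) : desc i j = [] := by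
  have : i + 1 - j = 0 := by omega
  simp [desc, this]

lemma desc_split {m a c : ℕ} (h1 : a ≤ c + 1) (h2 : c ≤ m) :
    desc m a = desc m (c + 1) ++ desc c a := by
  obtain ⟨p, hp⟩ : ∃ p, c + 1 = a + p := ⟨c + 1 - a, by omega⟩
  obtain ⟨q, rfl⟩ : ∃ q, m = c + q := ⟨m - c, by omega⟩
  have e1 : c + q + 1 - a = p + q := by omega
  have e2 : c + q + 1 - (c + 1) = q := by omega
  have e3 : c + 1 - a = p := by omega
  simp only [desc, e1, e2, e3, ← List.reverse_append]
  rw [hp, List.range'_append_1]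

lemma desc_self (m : ℕ) : desc m m = [m] := by
  simp [desc]

lemma desc_succ_left {m a : ℕ} (h : a ≤ m + 1) : desc (m + 1) a = (m + 1) :: desc m a := by
  rw [desc_split h (Nat.le_succ m), desc_self]
  rfl

lemma desc_eq_append {m b : ℕ} (h : b + 1 ≤ m) : desc m (b + 1) = desc m (b + 2) ++ [b + 1] := by
  rw [desc_split (c := b + 1) (by omega) h, desc_self]

lemma mem_desc {m a k : ℕ} : k ∈ desc m a ↔ a ≤ k ∧ k ≤ m := by
  simp only [desc, List.mem_reverse, List.mem_range'_1]
  omega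

lemma length_desc (m a : ℕ) : (desc m a).length = m + 1 - a := by
  simp [desc]

/-- The relations between the generators of a nil-Coxeter or Coxeter monoid of type `A` that do
not involve squares. -/
structure BraidRelations {M : Type*} [Monoid M] (τ : ℕ → M) : Prop where
  comm : ∀ i j, i + 2 ≤ j → τ i * τ j = τ j * τ i
  braid : ∀ i, τ i * τ (i + 1) * τ i = τ (i + 1) * τ i * τ (i + 1)

section Braid

variable {M : Type*} [Monoid M] {τ : ℕ → M}

lemma BraidRelations.commute_prod (hτ : BraidRelations τ) {t : ℕ} {w : List ℕ}
    (h : ∀ k ∈ w, k + 2 ≤ t ∨ t + 2 ≤ k) : Commute (τ t) (w.map τ).prod := by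
  apply Commute.list_prod_right
  intro x hx
  obtain ⟨k, hk, rfl⟩ := List.mem_map.1 hx
  rcases h k hk with h | h
  · exact (hτ.comm k t h).symm
  · exact hτ.comm t k h

/-- The letter `b + 1` commutes past the letters below `b`, turns into `b` by a braid move with `b +
1, b`, and commutes past the letters above `b + 1`. -/
lemma BraidRelations.desc_mul (hτ : BraidRelations τ) {m a b : ℕ} (hab : a ≤ b) (hb : b + 1 ≤ m) :
    ((desc m a).map τ).prod * τ (b + 1) = τ b * ((desc m a).map τ).prod := by
  have e : desc m a = desc m (b + 2) ++ (b + 1) :: desc b a := by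
    rw [desc_split (c := b + 1) (by omega) hb, desc_succ_left (by omega)]
  have hlow : ∀ c, b = c + 1 → a ≤ c + 1 →
      ((desc b a).map τ).prod * τ (b + 1) = τ b * τ (b + 1) * ((desc c a).map τ).prod := by
    rintro c rfl hc
    rw [desc_succ_left hc, List.map_cons, List.prod_cons, mul_assoc, mul_assoc,
      (hτ.commute_prod (t := c + 1 + 1) (w := desc c a)
        (fun k hk => Or.inl (by have := mem_desc.1 hk; omega))).eq]
  have hhigh := (hτ.commute_prod (t := b) (w := desc m (b + 2))
        (fun k hk => Or.inr (by have := mem_desc.1 hk; omega))).eq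
  rw [e, List.map_append, List.prod_append, List.map_cons, List.prod_cons]
  rcases Nat.eq_zero_or_pos b with rfl | hpos
  · obtain rfl : a = 0 := by omega
    have : desc 0 0 = [0] := desc_self 0
    rw [this]
    simp only [List.map_cons, List.map_nil, List.prod_cons, List.prod_nil, mul_one]
    simp only [← mul_assoc]
    rw [hhigh]
    simp only [mul_assoc]
    rw [← mul_assoc (τ (0 + 1)), ← mul_assoc (τ 0), hτ.braid]
  · obtain ⟨c, rfl⟩ : ∃ c, b = c + 1 := ⟨b - 1, by omega⟩
    rw [mul_assoc, mul_assoc, hlow c rfl hab, ← mul_assoc (τ (c + 1)) _ (_ * _), hhigh]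
    have hbr : ∀ x, τ (c + 1) * (τ (c + 1 + 1) * (τ (c + 1) * x)) =
        τ (c + 1 + 1) * (τ (c + 1) * (τ (c + 1 + 1) * x)) := fun x => by
      simp only [← mul_assoc]
      rw [hτ.braid]
    rw [desc_succ_left hab, List.map_cons, List.prod_cons]
    simp only [mul_assoc, hbr]

lemma BraidRelations.desc_mul_desc (hτ : BraidRelations τ) {m a : ℕ} : ∀ (d b : ℕ),
    b + d = m + 1 → a ≤ b →
    ((desc (m + 1) a).map τ).prod * ((desc (m + 1) (b + 1)).map τ).prod =
      ((desc m b).map τ).prod * ((desc (m + 1) a).map τ).prod := by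
  intro d
  induction d with
  | zero =>
    intro b hb _
    rw [desc_of_lt (i := m + 1) (j := b + 1) (by omega), desc_of_lt (i := m) (j := b) (by omega)]
    simp
  | succ d ih =>
    intro b hb hab
    have h := ih (b + 1) (by omega) (by omega)
    have e : desc m b = desc m (b + 1) ++ [b] := by
      rw [desc_split (c := b) (by omega) (by omega), desc_self]
    rw [desc_eq_append (m := m + 1) (by omega), e]
    simp only [List.map_append, List.prod_append, List.map_cons, List.map_nil, List.prod_cons,
      List.prod_nil, mul_one]
    rw [← mul_assoc, h, mul_assoc, hτ.desc_mul hab (by omega), mul_assoc]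

end Braid

/-! ### Left multiplication by an adjacent transposition on index sequences -/

/-- The index sequence of `s_t u` when `i` is that of `u` and `i_{t-1} < i_t`. -/
def step (t : ℕ) (i : ℕ → ℕ) : ℕ → ℕ :=
  fun k => if k + 1 = t then i t - 1 else if k = t then i (t - 1) else i k

lemma step_pred {t : ℕ} (i : ℕ → ℕ) : step (t + 1) i t = i (t + 1) - 1 := by simp [step]

lemma step_self {t : ℕ} (i : ℕ → ℕ) : step (t + 1) i (t + 1) = i t := by simp [step]

lemma step_of_ne {t k : ℕ} (i : ℕ → ℕ) (h : k ≠ t) (h' : k ≠ t + 1) : step (t + 1) i k = i k := by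
  simp [step, h, h']

lemma IsCode.step {n t : ℕ} {i : ℕ → ℕ} (hi : IsCode n i) (ht : t + 1 < n) (h : i t < i (t + 1)) :
    IsCode n (step (t + 1) i) := by
  refine ⟨fun j => ?_, fun j hj => ?_⟩
  · have h0 := hi.1 t
    have h1 := hi.1 (t + 1)
    by_cases hj : j = t
    · rw [hj, step_pred]
      omega
    by_cases hj' : j = t + 1
    · rw [hj', step_self]
      omega
    rw [step_of_ne i hj hj']
    exact hi.1 j
  · rw [step_of_ne i (by omega) (by omega)]
    exact hi.2 j hj

/-- The inverse of `step`. -/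
def unstep (t : ℕ) (i : ℕ → ℕ) : ℕ → ℕ :=
  fun k => if k = t then i (t + 1) else if k = t + 1 then i t + 1 else i k

lemma step_unstep (t : ℕ) (i : ℕ → ℕ) : step (t + 1) (unstep t i) = i := by
  funext k
  by_cases h : k = t
  · rw [h, step_pred]
    simp [unstep]
  by_cases h' : k = t + 1
  · rw [h', step_self]
    simp [unstep]
  rw [step_of_ne _ h h']
  simp [unstep, h, h']

lemma IsCode.unstep {n t : ℕ} {i : ℕ → ℕ} (hi : IsCode n i) (ht : t + 1 < n)
    (h : i (t + 1) ≤ i t) : IsCode n (unstep t i) ∧ unstep t i t < unstep t i (t + 1) := by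
  refine ⟨⟨fun j => ?_, fun j hj => ?_⟩, ?_⟩
  · have h0 := hi.1 t
    have h1 := hi.1 (t + 1)
    have h2 := hi.1 j
    unfold SchubertLead.unstep
    split_ifs <;> omega
  · have h2 := hi.2 j hj
    unfold SchubertLead.unstep
    split_ifs <;> omega
  · simp [SchubertLead.unstep]
    omega

lemma IsCode.zero {n : ℕ} {i : ℕ → ℕ} (hi : IsCode n i) : i 0 = 1 := by
  have := hi.1 0
  omega

lemma codeWord_succ_of_code {n : ℕ} {i : ℕ → ℕ} (h0 : 1 ≤ i 0) :
    codeWord (n + 1) i = codeWord n i ++ desc n (i n) := by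
  rcases Nat.eq_zero_or_pos n with rfl | h
  · rw [codeWord_one le_rfl, codeWord_one (Nat.zero_le _), desc_of_lt (by omega)]
    rfl
  · exact codeWord_succ h i

lemma BraidRelations.codeWord_step {M : Type*} [Monoid M] {τ : ℕ → M} (hτ : BraidRelations τ)
    {t : ℕ} {i : ℕ → ℕ} (hi : ∀ j, 1 ≤ i j ∧ i j ≤ j + 1) (h : i t < i (t + 1)) (d : ℕ) :
    ((codeWord (t + 2 + d) (step (t + 1) i)).map τ).prod =
      τ (t + 1) * ((codeWord (t + 2 + d) i).map τ).prod := by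
  have hs : 1 ≤ step (t + 1) i 0 := by
    have h0 := hi 0
    have h1 := hi (t + 1)
    have h2 := hi t
    rcases Nat.eq_zero_or_pos t with rfl | ht
    · rw [step_pred]
      omega
    · rw [step_of_ne i (by omega) (by omega)]
      omega
  induction d with
  | zero =>
    obtain ⟨b, hb⟩ : ∃ b, i (t + 1) = b + 1 := ⟨i (t + 1) - 1, by omega⟩
    have hb' := hi (t + 1)
    have ht := hi t
    rw [Nat.add_zero, codeWord_succ_of_code (n := t + 1) hs, codeWord_succ_of_code (n := t) hs,
      codeWord_succ_of_code (n := t + 1) (hi 0).1, codeWord_succ_of_code (n := t) (hi 0).1,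
      step_pred, step_self, codeWord_congr (i' := i) (fun j hj => step_of_ne i (by omega) (by omega))]
    have hcomm := (hτ.commute_prod (t := t + 1) (w := codeWord t i)
        (fun k hk => Or.inl (by have := isWord_codeWord hi k hk; omega))).eq
    simp only [List.map_append, List.prod_append]
    -- With `s_{t+1,i_t} = s_{t+1} s_{t,i_t}` this reads `s_{t+1} s_{t,i_t} s_{t+1,b+1} = s_{t,b}
    -- s_{t+1,i_t}`, where `b + 1 = i_{t+1}`; the earlier factors commute with `s_{t+1}`.
    have key := hτ.desc_mul_desc (m := t) (a := i t) (t + 1 - b) b (by omega) (by omega)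
    rw [← mul_assoc, ← mul_assoc, hcomm, hb, Nat.add_sub_cancel]
    conv_rhs at key => rw [desc_succ_left (m := t) (a := i t) (by omega)]
    conv_lhs at key => rw [desc_succ_left (m := t) (a := i t) (by omega)]
    rw [desc_succ_left (m := t) (a := i t) (by omega), mul_assoc, ← key]
    simp only [List.map_cons, List.prod_cons, mul_assoc]
  | succ d ih =>
    rw [← Nat.add_assoc, codeWord_succ_of_code hs, codeWord_succ_of_code (hi 0).1,
      step_of_ne i (by omega) (by omega)]
    simp only [List.map_append, List.prod_append]
    rw [ih, mul_assoc]

lemma braidRelations_adj : BraidRelations adj := ⟨fun _ _ => adj_comm, adj_braid⟩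

lemma braidRelations_divDiffLin : BraidRelations divDiffLin :=
  ⟨fun _ _ h => LinearMap.ext fun f => divDiff_comm h f,
    fun i => LinearMap.ext fun f => divDiff_braid i f⟩

lemma divDiffWord_eq_prod (w : List ℕ) (f : MvPolynomial ℕ ℤ) :
    divDiffWord w f = (w.map divDiffLin).prod f := by
  induction w with
  | nil => rfl
  | cons t w ih =>
    rw [List.map_cons, List.prod_cons]
    exact congrArg (divDiff t) ih

lemma wordProd_step {n t : ℕ} {i : ℕ → ℕ} (hi : IsCode n i) (ht : t + 1 < n)
    (h : i t < i (t + 1)) :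
    wordProd (codeWord n (step (t + 1) i)) = adj (t + 1) * wordProd (codeWord n i) := by
  obtain ⟨d, rfl⟩ : ∃ d, n = t + 2 + d := ⟨n - (t + 2), by omega⟩
  exact braidRelations_adj.codeWord_step hi.1 h d

lemma divDiffWord_step {n t : ℕ} {i : ℕ → ℕ} (hi : IsCode n i) (ht : t + 1 < n)
    (h : i t < i (t + 1)) (f : MvPolynomial ℕ ℤ) :
    divDiffWord (codeWord n (step (t + 1) i)) f =
      divDiff (t + 1) (divDiffWord (codeWord n i) f) := by
  obtain ⟨d, rfl⟩ : ∃ d, n = t + 2 + d := ⟨n - (t + 2), by omega⟩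
  rw [divDiffWord_eq_prod, braidRelations_divDiffLin.codeWord_step hi.1 h d, divDiffWord_eq_prod]
  rfl

lemma length_codeWord_step {n t : ℕ} {i : ℕ → ℕ} (hi : IsCode n i) (ht : t + 1 < n)
    (h : i t < i (t + 1)) :
    (codeWord n (step (t + 1) i)).length = (codeWord n i).length + 1 := by
  obtain ⟨d, rfl⟩ : ∃ d, n = t + 2 + d := ⟨n - (t + 2), by omega⟩
  have hs := (hi.step ht h).zero.ge
  have h0 := hi.zero.ge
  clear ht
  have h1 := hi.1 t
  have h2 := hi.1 (t + 1)
  clear hi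
  induction d with
  | zero =>
    rw [Nat.add_zero, codeWord_succ_of_code (n := t + 1) hs, codeWord_succ_of_code (n := t) hs,
      codeWord_succ_of_code (n := t + 1) h0, codeWord_succ_of_code (n := t) h0,
      step_pred, step_self, codeWord_congr (i' := i) (fun j hj => step_of_ne i (by omega) (by omega))]
    simp only [List.length_append, length_desc]
    omega
  | succ d ih =>
    rw [← Nat.add_assoc, codeWord_succ_of_code hs, codeWord_succ_of_code h0,
      step_of_ne i (by omega) (by omega)]
    simp only [List.length_append, ih]
    omega

/-! ### Reduced words -/

lemma IsCode.eq_of_wordProd_eq {n : ℕ} {i i' : ℕ → ℕ} (hi : IsCode n i) (hi' : IsCode n i')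
    (h : wordProd (codeWord n i) = wordProd (codeWord n i')) : i = i' := by
  funext j
  by_cases hj : j < n
  · exact code_unique n i i' hi.1 hi'.1 h j hj
  · rw [hi.2 j (by omega), hi'.2 j (by omega)]

lemma code_eq {n : ℕ} {u : SymGroup n} {i : ℕ → ℕ} (hi : IsCode n i)
    (h : wordProd (codeWord n i) = u) : code u = i :=
  (code_spec u).1.eq_of_wordProd_eq hi ((code_spec u).2.trans h.symm)

/-- Normal forms are reduced: prepending a letter acts on the index sequence by `step` or by its
inverse, so the length of the normal form grows by at most one per letter. -/
lemma length_codeWord_le {n : ℕ} : ∀ (v : List ℕ) (i : ℕ → ℕ), IsWord n v → IsCode n i →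
    wordProd (codeWord n i) = wordProd v → (codeWord n i).length ≤ v.length := by
  have h1 : IsCode n (fun j => j + 1) := ⟨fun j => ⟨Nat.succ_pos j, le_rfl⟩, fun j _ => rfl⟩
  have hnil : codeWord n (fun j => j + 1) = [] := by
    simp [codeWord, desc_of_lt]
  intro v
  induction v with
  | nil =>
    intro i _ hi h
    rw [hi.eq_of_wordProd_eq h1 (by rw [h, hnil]), hnil]
  | cons t v ih =>
    intro i hv hi h
    have hv' : IsWord n v := fun k hk => hv k (List.mem_cons_of_mem _ hk)
    have ht := hv t List.mem_cons_self
    obtain ⟨t, rfl⟩ : ∃ s, t = s + 1 := ⟨t - 1, by omega⟩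
    obtain ⟨i', hi', hw⟩ := exists_code n _ (wordProd_mem hv')
    have hlen := ih i' hv' hi' hw
    have hp : wordProd ((t + 1) :: v) = adj (t + 1) * wordProd v := by simp [wordProd]
    rcases lt_or_ge (i' t) (i' (t + 1)) with hlt | hge
    · have := wordProd_step hi' (by omega) hlt
      rw [hi.eq_of_wordProd_eq (hi'.step (by omega) hlt) (by rw [h, hp, this, hw]),
        length_codeWord_step hi' (by omega) hlt, List.length_cons]
      omega
    · obtain ⟨hu, hlt⟩ := hi'.unstep (by omega) hge
      have h2 := wordProd_step hu (by omega) hlt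
      have h3 := length_codeWord_step hu (by omega) hlt
      rw [step_unstep] at h2 h3
      rw [hi.eq_of_wordProd_eq hu (by rw [h, hp, ← hw, h2, ← mul_assoc, adj_mul_self, one_mul]),
        List.length_cons]
      omega

/-- If the inequality fails, `unstep` gives a shorter word for the same permutation; if it holds,
the normal form given by `step` has the length of this word and is minimal. -/
lemma isReducedWord_cons_iff {n t : ℕ} {i : ℕ → ℕ} (hi : IsCode n i) (ht : t + 1 < n) :
    IsReducedWord n ((t + 1) :: codeWord n i) ↔ i t < i (t + 1) := by
  have hp : wordProd ((t + 1) :: codeWord n i) = adj (t + 1) * wordProd (codeWord n i) := by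
    simp [wordProd]
  constructor
  · intro h
    by_contra hge
    obtain ⟨hu, hlt⟩ := hi.unstep ht (not_lt.1 hge)
    have h2 := wordProd_step hu ht hlt
    have h3 := length_codeWord_step hu ht hlt
    rw [step_unstep] at h2 h3
    have := h.2 _ (isWord_codeWord hu.1)
      (by rw [hp, h2, ← mul_assoc, adj_mul_self, one_mul])
    rw [List.length_cons] at this
    omega
  · intro h
    refine ⟨fun k hk => ?_, fun v hv hvw => ?_⟩
    · rcases List.mem_cons.1 hk with rfl | hk
      · omega
      · exact isWord_codeWord hi.1 k hk
    · have := length_codeWord_le v _ hv (hi.step ht h)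
        (by rw [hvw, hp, wordProd_step hi ht h])
      rwa [length_codeWord_step hi ht h] at this

/-! ### The exponents of the monomials `X_j` -/

lemma wordProd_cons (t : ℕ) (w : List ℕ) : wordProd (t :: w) = adj t * wordProd w := by
  simp [wordProd]

lemma wordProd_apply_of_forall_ne {w : List ℕ} {k : ℕ} (h : ∀ l ∈ w, k ≠ l ∧ k ≠ l + 1) :
    wordProd w k = k := by
  induction w with
  | nil => rfl
  | cons t w ih =>
    rw [wordProd_cons, Equiv.Perm.mul_apply, ih fun l hl => h l (List.mem_cons_of_mem _ hl)]
    have := h t List.mem_cons_self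
    exact adj_of_ne this.1 this.2

lemma wordProd_desc_apply_of_lt {r b k : ℕ} (h : k < b) : wordProd (desc r b) k = k :=
  wordProd_apply_of_forall_ne fun l hl => by have := mem_desc.1 hl; omega

lemma wordProd_desc_apply_of_gt {r b k : ℕ} (h : r + 1 < k) : wordProd (desc r b) k = k :=
  wordProd_apply_of_forall_ne fun l hl => by have := mem_desc.1 hl; omega

lemma wordProd_desc_apply_self {r b : ℕ} (h : b ≤ r + 1) : wordProd (desc r b) b = r + 1 :=
  wordProd_desc_apply r (r + 1 - b) b (by omega)

lemma wordProd_desc_apply_succ {r b c : ℕ} (hb : 1 ≤ b) (h : b ≤ c) (hc : c ≤ r) :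
    wordProd (desc r b) (c + 1) = c := by
  obtain ⟨c, rfl⟩ : ∃ d, c = d + 1 := ⟨c - 1, by omega⟩
  rw [desc_split (c := c + 1) (by omega) hc, desc_succ_left h, wordProd_append, wordProd_cons,
    Equiv.Perm.mul_apply, Equiv.Perm.mul_apply, wordProd_desc_apply_of_gt (r := c) (by omega), adj_right,
    wordProd_desc_apply_of_lt (by omega)]

lemma codeWord_apply_of_gt {q k : ℕ} {i : ℕ → ℕ} (hi : ∀ j, 1 ≤ i j ∧ i j ≤ j + 1) (h : q < k) :
    wordProd (codeWord q i) k = k :=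
  wordProd_apply_of_forall_ne fun l hl => by have := isWord_codeWord hi l hl; omega

lemma codeWord_apply_mem {q k : ℕ} {i : ℕ → ℕ} (hi : ∀ j, 1 ≤ i j ∧ i j ≤ j + 1)
    (h : 1 ≤ k ∧ k ≤ q) : 1 ≤ wordProd (codeWord q i) k ∧ wordProd (codeWord q i) k ≤ q := by
  have hm := mem_sym.1 (wordProd_mem (isWord_codeWord (n := q) hi))
  by_contra hne
  have := (wordProd (codeWord q i)).injective (hm _ hne)
  rw [this] at hne
  exact hne h

/-- `s_{r,b}` is the cycle with `b ↦ r + 1` and `c + 1 ↦ c` for `b ≤ c ≤ r`, so it maps `{1, …, p}`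
onto `{1, …, p - 1} ∪ {r + 1}`. -/
lemma sum_desc {A : Type*} [AddCommMonoid A] (f : ℕ → A) {r b : ℕ} (hb : 1 ≤ b) :
    ∀ p, b ≤ p → p ≤ r + 1 →
      ∑ a ∈ Finset.Icc 1 p, f (wordProd (desc r b) a) =
        f (r + 1) + ∑ a ∈ Finset.Icc 1 (p - 1), f a := by
  intro p hp
  induction p, hp using Nat.le_induction with
  | base =>
    intro hr
    obtain ⟨c, rfl⟩ : ∃ c, b = c + 1 := ⟨b - 1, by omega⟩
    rw [Finset.sum_Icc_succ_top (by omega), wordProd_desc_apply_self hr, add_comm,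
      Nat.add_sub_cancel]
    congr 1
    refine Finset.sum_congr rfl fun a ha => ?_
    rw [wordProd_desc_apply_of_lt (by have := Finset.mem_Icc.1 ha; omega)]
  | succ p hp ih =>
    intro hr
    obtain ⟨c, rfl⟩ : ∃ c, p = c + 1 := ⟨p - 1, by omega⟩
    rw [Finset.sum_Icc_succ_top (by omega), ih (by omega),
      wordProd_desc_apply_succ hb hp (by omega), Nat.add_sub_cancel, Nat.add_sub_cancel,
      Finset.sum_Icc_succ_top (by omega), add_assoc]

lemma sum_desc_of_lt {A : Type*} [AddCommMonoid A] (f : ℕ → A) {r b p : ℕ} (h : p < b) :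
    ∑ a ∈ Finset.Icc 1 p, f (wordProd (desc r b) a) = ∑ a ∈ Finset.Icc 1 p, f a := by
  refine Finset.sum_congr rfl fun a ha => ?_
  rw [wordProd_desc_apply_of_lt (by have := Finset.mem_Icc.1 ha; omega)]

lemma sum_desc_of_gt {A : Type*} [AddCommMonoid A] (f : ℕ → A) {r b p : ℕ} (hb : 1 ≤ b)
    (hbr : b ≤ r + 1) (h : r < p) :
    ∑ a ∈ Finset.Icc 1 p, f (wordProd (desc r b) a) = ∑ a ∈ Finset.Icc 1 p, f a := by
  obtain ⟨d, rfl⟩ : ∃ d, p = r + 1 + d := ⟨p - (r + 1), by omega⟩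
  clear h
  induction d with
  | zero =>
    rw [Nat.add_zero, sum_desc f hb (r + 1) hbr le_rfl, Finset.sum_Icc_succ_top (by omega),
      Nat.add_sub_cancel, add_comm]
  | succ d ih =>
    rw [← Nat.add_assoc, Finset.sum_Icc_succ_top (by omega), Finset.sum_Icc_succ_top (by omega), ih,
      wordProd_desc_apply_of_gt (by omega)]

/-- The exponents of the product of the variables `x_{u(1)}, …, x_{u(p)}` for the permutation
`u = s_{1,i_1} ⋯ s_{q-1,i_{q-1}}`. -/
noncomputable def imageExp (i : ℕ → ℕ) (q p : ℕ) : ℕ →₀ ℕ :=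
  ∑ a ∈ Finset.Icc 1 p, Finsupp.single (wordProd (codeWord q i) a) 1

/-- The last factor acts first, and `q + 1` is fixed by the earlier ones. So a factor with `p ∈
[i_q, q]` contributes `x_{q+1}` and lowers `p` by one; by the next lemma all others leave the set
`{1, …, p}` alone. -/
lemma imageExp_succ {i : ℕ → ℕ} (hi : ∀ j, 1 ≤ i j ∧ i j ≤ j + 1) {q p : ℕ}
    (h : i q ≤ p) (h' : p ≤ q + 1) :
    imageExp i (q + 1) p = Finsupp.single (q + 1) 1 + imageExp i q (p - 1) := by
  unfold imageExp
  rw [codeWord_succ_of_code (hi 0).1, wordProd_append]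
  simp only [Equiv.Perm.mul_apply]
  rw [sum_desc (fun a => Finsupp.single (wordProd (codeWord q i) a) 1) (hi q).1 p h h',
    codeWord_apply_of_gt hi (Nat.lt_succ_self q)]

lemma imageExp_succ_of_not {i : ℕ → ℕ} (hi : ∀ j, 1 ≤ i j ∧ i j ≤ j + 1) {q p : ℕ}
    (h : ¬ (i q ≤ p ∧ p ≤ q)) :
    imageExp i (q + 1) p = imageExp i q p := by
  unfold imageExp
  rw [codeWord_succ_of_code (hi 0).1, wordProd_append]
  simp only [Equiv.Perm.mul_apply]
  rcases lt_or_ge p (i q) with h1 | h1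
  · exact sum_desc_of_lt (fun a => Finsupp.single (wordProd (codeWord q i) a) 1) h1
  · exact sum_desc_of_gt (fun a => Finsupp.single (wordProd (codeWord q i) a) 1) (hi q).1 (hi q).2
      (by omega)

lemma imageExp_eq_of_forall_not {i : ℕ → ℕ} (hi : ∀ j, 1 ≤ i j ∧ i j ≤ j + 1) {q q' p : ℕ}
    (hq : q' ≤ q) (h : ∀ j, q' ≤ j → j < q → ¬ (i j ≤ p ∧ p ≤ j)) :
    imageExp i q p = imageExp i q' p := by
  induction q, hq using Nat.le_induction with
  | base => rfl
  | succ q hq ih =>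
    rw [imageExp_succ_of_not hi (h q hq (Nat.lt_succ_self q)),
      ih fun j h1 h2 => h j h1 (by omega)]

lemma imageExp_of_le_one {i : ℕ → ℕ} {q : ℕ} (hq : q ≤ 1) (p : ℕ) :
    imageExp i q p = ∑ a ∈ Finset.Icc 1 p, Finsupp.single a 1 := by
  unfold imageExp
  rw [codeWord_one hq]
  rfl

lemma mem_mSet {i : ℕ → ℕ} {r l p j : ℕ} :
    j ∈ mSet i r l p ↔ (1 ≤ j ∧ j < p) ∧ i j ≤ i r - l ∧ i r - l ≤ j := by
  simp [mSet]

lemma qIdx_succ_mem {i : ℕ → ℕ} {r l : ℕ} (h : mSet i r (l + 1) (qIdx i r l) ≠ ∅) :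
    qIdx i r (l + 1) ∈ mSet i r (l + 1) (qIdx i r l) := by
  have h1 := Finset.nonempty_iff_ne_empty.2 h
  have : qIdx i r (l + 1) = (mSet i r (l + 1) (qIdx i r l)).max' h1 := by
    rw [qIdx, Finset.max'_eq_sup', ← Finset.sup'_eq_sup h1]
  rw [this]
  exact Finset.max'_mem _ _

lemma le_qIdx_succ {i : ℕ → ℕ} {r l j : ℕ} (h : j ∈ mSet i r (l + 1) (qIdx i r l)) :
    j ≤ qIdx i r (l + 1) :=
  Finset.le_sup (f := id) h

/-- The `q_{r,l}` strictly decrease as long as the sets are non-empty. Without this, the infimum in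
`mIdx` could be the default value `0`. -/
lemma exists_mSet_eq_empty (i : ℕ → ℕ) (r : ℕ) : ∃ l, mSet i r (l + 1) (qIdx i r l) = ∅ := by
  by_contra! h
  have h1 : ∀ l, qIdx i r l + l ≤ r := by
    intro l
    induction l with
    | zero => exact le_rfl
    | succ l ih =>
      have := mem_mSet.1 (qIdx_succ_mem (Finset.nonempty_iff_ne_empty.1 (h l)))
      omega
  have h2 := h1 (r + 1)
  omega

lemma mSet_mIdx (i : ℕ → ℕ) (r : ℕ) : mSet i r (mIdx i r + 1) (qIdx i r (mIdx i r)) = ∅ :=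
  Nat.sInf_mem (exists_mSet_eq_empty i r)

lemma mSet_ne_empty {i : ℕ → ℕ} {r l : ℕ} (h : l < mIdx i r) :
    mSet i r (l + 1) (qIdx i r l) ≠ ∅ :=
  Nat.notMem_of_lt_sInf h

/-- Reading the factors from right to left, `p = i_r - 1 - l` after `l` contributions, and the next
factor to contribute is the one with the largest `j < q_{r,l}` such that `p ∈ [i_j, j]`, which is
`q_{r,l+1}`. -/
lemma imageExp_eq_sum_qIdx {i : ℕ → ℕ} (hi : ∀ j, 1 ≤ i j ∧ i j ≤ j + 1) (r l : ℕ)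
    (hl : l ≤ mIdx i r) :
    imageExp i r (i r - 1) = (∑ k ∈ Finset.Icc 1 l, Finsupp.single (1 + qIdx i r k) 1) +
      imageExp i (qIdx i r l) (i r - l - 1) := by
  induction l with
  | zero => simp [qIdx]
  | succ l ih =>
    rw [ih (by omega)]
    have hmem := qIdx_succ_mem (mSet_ne_empty (show l < mIdx i r by omega))
    have h1 := mem_mSet.1 hmem
    rw [imageExp_eq_of_forall_not hi (q' := qIdx i r (l + 1) + 1) (by omega),
      show i r - l - 1 = i r - (l + 1) by omega,
      imageExp_succ hi h1.2.1 (by omega), Finset.sum_Icc_succ_top (by omega), add_assoc,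
      Nat.add_comm 1 (qIdx i r (l + 1))]
    rintro j hj hj' ⟨h2, h3⟩
    have := le_qIdx_succ (mem_mSet.2 ⟨⟨by omega, hj'⟩, by omega, by omega⟩)
    omega

lemma monX_eq_imageExp {i : ℕ → ℕ} (hi : ∀ j, 1 ≤ i j ∧ i j ≤ j + 1) (r : ℕ) :
    monX i r = imageExp i r (i r - 1) := by
  rw [imageExp_eq_sum_qIdx hi r (mIdx i r) le_rfl, monX, add_comm]
  congr 1
  rcases Nat.eq_zero_or_pos (qIdx i r (mIdx i r)) with h | h
  · rw [h, imageExp_of_le_one (Nat.zero_le 1)]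
  rw [imageExp_eq_of_forall_not hi (q' := 1) h, imageExp_of_le_one le_rfl]
  rintro j hj hj' ⟨h2, h3⟩
  have : j ∈ mSet i r (mIdx i r + 1) (qIdx i r (mIdx i r)) :=
    mem_mSet.2 ⟨⟨hj, hj'⟩, by omega, by omega⟩
  rw [mSet_mIdx] at this
  simp at this

/-- The exponents of `X_{n-1} ⋯ X_1` for the index sequence `i`. -/
noncomputable def codeExp (n : ℕ) (i : ℕ → ℕ) : ℕ →₀ ℕ :=
  ∑ j ∈ Finset.range n, imageExp i j (i j - 1)

lemma sum_monX_eq_codeExp {n : ℕ} {i : ℕ → ℕ} (hi : ∀ j, 1 ≤ i j ∧ i j ≤ j + 1) :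
    ∑ j ∈ Finset.Icc 1 (n - 1), monX i j = codeExp n i := by
  rcases Nat.eq_zero_or_pos n with rfl | hn
  · simp [codeExp]
  obtain ⟨m, rfl⟩ : ∃ m, n = m + 1 := ⟨n - 1, by omega⟩
  rw [codeExp, Finset.sum_congr rfl fun j _ => monX_eq_imageExp hi j, Finset.range_eq_Ico,
    Finset.sum_eq_sum_Ico_succ_bot (by omega)]
  -- The extra index `0` contributes nothing, as `i 0 = 1`.
  have : imageExp i 0 (i 0 - 1) = 0 := by
    have := hi 0
    rw [show i 0 - 1 = 0 by omega]
    simp [imageExp]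
  rw [this, zero_add]
  rfl

/-! ### The effect of `step` on the exponents -/

lemma codeExp_succ (n : ℕ) (i : ℕ → ℕ) :
    codeExp (n + 1) i = codeExp n i + imageExp i n (i n - 1) := Finset.sum_range_succ _ _

lemma imageExp_congr {i i' : ℕ → ℕ} {q : ℕ} (h : ∀ j < q, i j = i' j) (p : ℕ) :
    imageExp i q p = imageExp i' q p := by
  rw [imageExp, imageExp, codeWord_congr h]

lemma codeExp_congr {n : ℕ} {i i' : ℕ → ℕ} (h : ∀ j < n, i j = i' j) :
    codeExp n i = codeExp n i' := by
  refine Finset.sum_congr rfl fun j hj => ?_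
  rw [Finset.mem_range] at hj
  rw [h j hj, imageExp_congr fun k hk => h k (by omega)]

lemma imageExp_apply_eq_zero {i : ℕ → ℕ} (hi : ∀ j, 1 ≤ i j ∧ i j ≤ j + 1) {q p s : ℕ}
    (hp : p ≤ q) (hs : s = 0 ∨ q < s) : imageExp i q p s = 0 := by
  rw [imageExp, Finsupp.finsetSum_apply]
  refine Finset.sum_eq_zero fun a ha => ?_
  rw [Finset.mem_Icc] at ha
  have := codeWord_apply_mem hi (show 1 ≤ a ∧ a ≤ q by omega)
  exact Finsupp.single_eq_of_ne (by omega)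

lemma codeExp_apply_eq_zero {i : ℕ → ℕ} (hi : ∀ j, 1 ≤ i j ∧ i j ≤ j + 1) {n s : ℕ}
    (hs : s = 0 ∨ n ≤ s) : codeExp n i s = 0 := by
  rw [codeExp, Finsupp.finsetSum_apply]
  refine Finset.sum_eq_zero fun j hj => ?_
  rw [Finset.mem_range] at hj
  exact imageExp_apply_eq_zero hi (by have := hi j; omega) (by omega)

/-- For `r > t + 1` the prefix permutation is multiplied by `s_{t+1}` on the left, so `X_r` has its
variables swapped. Among the factors up to `t + 1`, the only affected variable is one `x_{t+1}` in
`X_{t+1}`; it becomes the extra `x_{t+2}`. -/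
lemma codeExp_step {n t : ℕ} {i : ℕ → ℕ} (hi : IsCode n i) (ht : t + 1 < n)
    (h : i t < i (t + 1)) :
    (codeExp n i).mapDomain (adj (t + 1)) =
      codeExp n (step (t + 1) i) + Finsupp.single (t + 2) 1 := by
  have hs := hi.step ht h
  obtain ⟨d, rfl⟩ : ∃ d, n = t + 2 + d := ⟨n - (t + 2), by omega⟩
  clear ht
  replace hi := hi.1
  replace hs := hs.1
  induction d with
  | zero =>
    have h1 := hi (t + 1)
    have h0 := hi t
    rw [Nat.add_zero, codeExp_succ (t + 1), codeExp_succ t, codeExp_succ (t + 1), codeExp_succ t,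
      step_pred, step_self, codeExp_congr (i' := i) (fun j hj => step_of_ne i (by omega) (by omega)),
      imageExp_congr (i' := i) (q := t) (fun j hj => step_of_ne i (by omega) (by omega)),
      imageExp_succ hi (by omega) (by omega), imageExp_succ_of_not hs (by rw [step_pred]; omega),
      imageExp_congr (i' := i) (q := t) (fun j hj => step_of_ne i (by omega) (by omega))]
    have e : ∀ k : ℕ →₀ ℕ, (∀ s, t < s → k s = 0) → k.mapDomain (adj (t + 1)) = k := by
      intro k hk
      exact mapDomain_adj_eq_self (by rw [hk _ (by omega), hk _ (by omega)])
    simp only [Finsupp.mapDomain_add, Finsupp.mapDomain_single, adj_left]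
    rw [e (codeExp t i) (fun s hs => codeExp_apply_eq_zero hi (by omega)),
      e (imageExp i t (i t - 1)) (fun s hs => imageExp_apply_eq_zero hi (by omega) (by omega)),
      e (imageExp i t (i (t + 1) - 1 - 1))
        (fun s hs => imageExp_apply_eq_zero hi (by omega) (by omega))]
    abel
  | succ d ih =>
    rw [← Nat.add_assoc, codeExp_succ, codeExp_succ, Finsupp.mapDomain_add, ih,
      step_of_ne i (by omega) (by omega)]
    have : ∀ p, (imageExp i (t + 2 + d) p).mapDomain (adj (t + 1)) =
        imageExp (step (t + 1) i) (t + 2 + d) p := by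
      intro p
      have hw : wordProd (codeWord (t + 2 + d) (step (t + 1) i)) =
          adj (t + 1) * wordProd (codeWord (t + 2 + d) i) :=
        braidRelations_adj.codeWord_step hi h d
      simp only [imageExp, Finsupp.mapDomain_finsetSum, Finsupp.mapDomain_single, hw,
        Equiv.Perm.mul_apply]
    rw [this]
    abel

lemma imageExp_apply {i : ℕ → ℕ} (q p s : ℕ) : imageExp i q p s =
    if 1 ≤ (wordProd (codeWord q i)).symm s ∧ (wordProd (codeWord q i)).symm s ≤ p
      then 1 else 0 := by
  rw [imageExp, Finsupp.finsetSum_apply]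
  simp only [Finsupp.single_apply, ← Equiv.eq_symm_apply, Finset.sum_ite_eq', Finset.mem_Icc]

/-- After the factor `t + 1` the values `t + 1` and `t + 2` sit at the positions `i_t` and
`i_{t+1}`; each later factor moves these positions by an increasing map. -/
lemma symm_codeWord_lt {i : ℕ → ℕ} (hi : ∀ j, 1 ≤ i j ∧ i j ≤ j + 1) {t : ℕ}
    (h : i t < i (t + 1)) (d : ℕ) :
    1 ≤ (wordProd (codeWord (t + 2 + d) i)).symm (t + 1) ∧
    (wordProd (codeWord (t + 2 + d) i)).symm (t + 1) <
      (wordProd (codeWord (t + 2 + d) i)).symm (t + 2) ∧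
    (wordProd (codeWord (t + 2 + d) i)).symm (t + 2) ≤ t + 2 + d := by
  have hmul : ∀ (n a b : ℕ), wordProd (desc n (i n)) a = b →
      (wordProd (codeWord (n + 1) i)).symm (wordProd (codeWord n i) b) = a := by
    rintro n a b rfl
    rw [Equiv.symm_apply_eq, codeWord_succ_of_code (hi 0).1, wordProd_append,
      Equiv.Perm.mul_apply]
  have h0 := hi t
  induction d with
  | zero =>
    have h1 := hi (t + 1)
    have e1 : (wordProd (codeWord (t + 2) i)).symm (t + 2) = i (t + 1) := by
      have := hmul (t + 1) (i (t + 1)) (t + 2) (wordProd_desc_apply_self h1.2)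
      rwa [codeWord_apply_of_gt hi (by omega)] at this
    have e2 : (wordProd (codeWord (t + 2) i)).symm (t + 1) = i t := by
      have := hmul (t + 1) (i t) (i t) (wordProd_desc_apply_of_lt h)
      have ht : wordProd (codeWord (t + 1) i) (i t) = t + 1 := by
        rw [codeWord_succ_of_code (hi 0).1, wordProd_append, Equiv.Perm.mul_apply,
          wordProd_desc_apply_self h0.2, codeWord_apply_of_gt hi (by omega)]
      rwa [ht] at this
    rw [Nat.add_zero, e1, e2]
    omega
  | succ d ih =>
    set n := t + 2 + d with hn
    set v := (wordProd (codeWord n i)).symm with hv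
    have hin := hi n
    have key : ∀ s, 1 ≤ v s → v s ≤ n → (wordProd (codeWord (n + 1) i)).symm s =
        if v s < i n then v s else v s + 1 := by
      intro s h1 h2
      have hs : wordProd (codeWord n i) (v s) = s := by rw [hv, Equiv.apply_symm_apply]
      split_ifs with h3
      · have := hmul n (v s) (v s) (wordProd_desc_apply_of_lt h3)
        rwa [hs] at this
      · have := hmul n (v s + 1) (v s) (wordProd_desc_apply_succ hin.1 (not_lt.1 h3) h2)
        rwa [hs] at this
    rw [← Nat.add_assoc, ← hn, key (t + 1) ih.1 (by omega), key (t + 2) (by omega) ih.2.2]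
    split_ifs <;> omega

/-- Up to the factor `t + 1`, `x_{t+1}` occurs and `x_{t+2}` does not. A later `X_r` collects the
values at an initial segment of positions, so by `symm_codeWord_lt` it contains `x_{t+1}` whenever
it contains `x_{t+2}`. -/
lemma codeExp_lt {n t : ℕ} {i : ℕ → ℕ} (hi : IsCode n i) (ht : t + 1 < n)
    (h : i t < i (t + 1)) : codeExp n i (t + 2) < codeExp n i (t + 1) := by
  obtain ⟨d, rfl⟩ : ∃ d, n = t + 2 + d := ⟨n - (t + 2), by omega⟩
  clear ht
  replace hi := hi.1
  induction d with
  | zero =>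
    have h1 := hi (t + 1)
    have h0 := hi t
    rw [Nat.add_zero, codeExp_apply_eq_zero hi (by omega), codeExp_succ,
      imageExp_succ hi (by omega) (by omega)]
    simp
  | succ d ih =>
    rw [← Nat.add_assoc, codeExp_succ, Finsupp.add_apply, Finsupp.add_apply]
    refine add_lt_add_of_lt_of_le ih ?_
    have := symm_codeWord_lt hi h d
    rw [imageExp_apply, imageExp_apply]
    split_ifs <;> omega

lemma codeExp_lt_iff {n t : ℕ} {i : ℕ → ℕ} (hi : IsCode n i) (ht : t + 1 < n) :
    codeExp n i (t + 2) < codeExp n i (t + 1) ↔ i t < i (t + 1) := by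
  refine ⟨fun h => ?_, codeExp_lt hi ht⟩
  by_contra hge
  obtain ⟨hu, hlt⟩ := hi.unstep ht (not_lt.1 hge)
  -- The sequence `i` is the `step` of `unstep t i`, whose exponents at `t + 1`, `t + 2` are `a >
  -- b`; those of `i` are therefore `b` and `a - 1`.
  have h1 := codeExp_step hu ht hlt
  have h2 := codeExp_lt hu ht hlt
  rw [step_unstep] at h1
  have h3 := DFunLike.congr_fun h1 (t + 1)
  have h4 := DFunLike.congr_fun h1 (t + 2)
  rw [mapDomain_adj_apply, adj_left] at h3
  rw [mapDomain_adj_apply, adj_right] at h4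
  rw [show t + 1 + 1 = t + 2 from rfl] at h3
  simp at h3 h4
  omega

/-! ### Isobaric divided differences -/

/-- The order-preserving injection of `ℕ` into itself that omits `j`. -/
def skip (j l : ℕ) : ℕ := if l < j then l else l + 1

lemma skip_of_lt {j l : ℕ} (h : l < j) : skip j l = l := if_pos h

lemma skip_of_le {j l : ℕ} (h : j ≤ l) : skip j l = l + 1 := if_neg (not_lt.2 h)

lemma skip_injective (j : ℕ) : Function.Injective (skip j) := by
  intro a b h
  unfold skip at h
  split_ifs at h <;> omega

lemma skip_lt_skip {j a b : ℕ} : skip j a < skip j b ↔ a < b := by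
  unfold skip
  split_ifs <;> omega

lemma exists_skip_eq {j l : ℕ} (h : l ≠ j) : ∃ l', skip j l' = l := by
  rcases lt_or_gt_of_ne h with h | h
  · exact ⟨l, skip_of_lt h⟩
  · exact ⟨l - 1, by rw [skip_of_le (by omega)]; omega⟩

lemma mapDomain_skip_self (j : ℕ) (k : ℕ →₀ ℕ) : k.mapDomain (skip j) j = 0 := by
  apply Finsupp.mapDomain_of_notMem_range
  rintro ⟨l, hl⟩
  unfold skip at hl
  split_ifs at hl <;> omega

lemma mapDomain_skip_apply (j : ℕ) (k : ℕ →₀ ℕ) (l : ℕ) :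
    k.mapDomain (skip j) (skip j l) = k l :=
  Finsupp.mapDomain_apply (skip_injective j) _ _

lemma mapDomain_skip_eq_self {j : ℕ} {k : ℕ →₀ ℕ} (h : ∀ l, j ≤ l → k l = 0) :
    k.mapDomain (skip j) = k := by
  ext l
  rcases lt_trichotomy l j with hl | rfl | hl
  · conv_lhs => rw [← skip_of_lt hl]
    exact mapDomain_skip_apply j k l
  · rw [mapDomain_skip_self, h l le_rfl]
  · obtain ⟨l', rfl⟩ := exists_skip_eq hl.ne'
    rw [mapDomain_skip_apply, h _ hl.le]
    apply h
    unfold skip at hl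
    split_ifs at hl <;> omega

lemma mapDomain_skip_lt {j : ℕ} {a b : ℕ →₀ ℕ} (h : ord.toSyn a < ord.toSyn b) :
    ord.toSyn (a.mapDomain (skip j)) < ord.toSyn (b.mapDomain (skip j)) := by
  rw [ord_lt_iff] at h ⊢
  rw [Finsupp.degree_mapDomain, Finsupp.degree_mapDomain]
  refine h.imp id (And.imp id ?_)
  rintro ⟨l, hl, hgt⟩
  refine ⟨skip j l, by rwa [mapDomain_skip_apply, mapDomain_skip_apply], fun s hs => ?_⟩
  by_cases hsj : s = j
  · rw [hsj, mapDomain_skip_self, mapDomain_skip_self]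
  · obtain ⟨s, rfl⟩ := exists_skip_eq hsj
    rw [mapDomain_skip_apply, mapDomain_skip_apply, hgt s (skip_lt_skip.1 hs)]

/-- The isobaric divided difference `π_t f = ∂_t (x_t f)`. -/
noncomputable def isoDiff (t : ℕ) : MvPolynomial ℕ ℤ →ₗ[ℤ] MvPolynomial ℕ ℤ :=
  divDiffLin t ∘ₗ LinearMap.mulLeft ℤ (MvPolynomial.X t)

lemma isoDiff_apply (t : ℕ) (f : MvPolynomial ℕ ℤ) :
    isoDiff t f = divDiff t (MvPolynomial.X t * f) := rfl

/-- The operator `π_j π_{j+1} ⋯ π_{j+d-1}`. -/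
noncomputable def isoChain (j : ℕ) : ℕ → MvPolynomial ℕ ℤ →ₗ[ℤ] MvPolynomial ℕ ℤ
  | 0 => LinearMap.id
  | d + 1 => isoChain j d ∘ₗ isoDiff (j + d)

lemma isoChain_succ (j d : ℕ) (f : MvPolynomial ℕ ℤ) :
    isoChain j (d + 1) f = isoChain j d (isoDiff (j + d) f) := rfl

lemma isoChain_succ_left (j d : ℕ) (f : MvPolynomial ℕ ℤ) :
    isoChain j (d + 1) f = isoDiff j (isoChain (j + 1) d f) := by
  induction d generalizing f with
  | zero => rfl
  | succ d ih =>
    rw [isoChain_succ, ih, isoChain_succ, show j + (d + 1) = j + 1 + d by omega]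

lemma swapVars_monomial_of_eq {t : ℕ} {k : ℕ →₀ ℕ} (h : k t = k (t + 1)) :
    swapVars t (MvPolynomial.monomial k 1) = MvPolynomial.monomial k 1 := by
  rw [swapVars_monomial, mapDomain_adj_eq_self h]

lemma isoChain_monomial_mul {j d : ℕ} {k : ℕ →₀ ℕ} (h : ∀ l, l ≤ j + d → k l = 0)
    (f : MvPolynomial ℕ ℤ) :
    isoChain j d (MvPolynomial.monomial k 1 * f) =
      MvPolynomial.monomial k 1 * isoChain j d f := by
  induction d generalizing f with
  | zero => rfl
  | succ d ih =>
    rw [isoChain_succ, isoChain_succ, isoDiff_apply, isoDiff_apply, mul_left_comm,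
      divDiff_mul_left (swapVars_monomial_of_eq (by rw [h _ (by omega), h _ (by omega)])),
      ih fun l hl => h l (by omega)]

lemma exists_of_mem_support_isoDiff {t : ℕ} {f : MvPolynomial ℕ ℤ} {l : ℕ →₀ ℕ}
    (hl : l ∈ (isoDiff t f).support) :
    ∃ k ∈ f.support, l.degree = k.degree ∧ ∀ s, t + 1 < s → l s = k s := by
  obtain ⟨k, hk, h⟩ := exists_divDiffRel_of_mem_support hl
  change k ∈ (MvPolynomial.X t * f).support at hk
  rw [MvPolynomial.support_X_mul] at hk
  obtain ⟨k, hk', rfl⟩ := Finset.mem_map.1 hk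
  refine ⟨k, hk', ?_, fun s hs => ?_⟩
  · have := h.1
    simp only [addLeftEmbedding_apply, map_add, Finsupp.degree_single] at this
    omega
  · rw [h.2.1 s (by omega) (by omega)]
    simp [show t ≠ s by omega]

/-- Degrees and the exponents beyond `x_{j+d}` survive the chain, so a comparison decided at a
higher variable survives too. -/
lemma exists_of_mem_support_isoChain {j d : ℕ} {f : MvPolynomial ℕ ℤ} {l : ℕ →₀ ℕ}
    (hl : l ∈ (isoChain j d f).support) :
    ∃ k ∈ f.support, l.degree = k.degree ∧ ∀ s, j + d < s → l s = k s := by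
  induction d generalizing f with
  | zero => exact ⟨l, hl, rfl, fun _ _ => rfl⟩
  | succ d ih =>
    rw [isoChain_succ] at hl
    obtain ⟨k, hk, h1, h2⟩ := ih hl
    obtain ⟨k', hk', h3, h4⟩ := exists_of_mem_support_isoDiff hk
    exact ⟨k', hk', h1.trans h3, fun s hs => (h2 s (by omega)).trans (h4 s (by omega))⟩

/-- With `m` the top index and `x^k = x^r x_m^a`, the first operator gives `x^r` times the sum of
all `x_m^p x_{m+1}^{a-p}`. The remaining operators do not touch `x_{m+1}`, so the term `x^r
x_{m+1}^a` dominates, and induction applies to `x^r`. -/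
lemma hasLead_isoChain_monomial (j d : ℕ) (k : ℕ →₀ ℕ) (hk : ∀ l, j + d ≤ l → k l = 0) :
    HasLead (isoChain j d (MvPolynomial.monomial k 1)) (k.mapDomain (skip j)) := by
  induction d generalizing k with
  | zero =>
    rw [mapDomain_skip_eq_self (j := j) hk]
    exact hasLead_monomial k
  | succ d ih =>
    set m := j + d with hm
    set r := k.erase m with hr
    have hrk : k = r + Finsupp.single m (k m) := (Finsupp.erase_add_single m k).symm
    set a := k m with ha
    have hrm : r m = 0 := Finsupp.erase_same
    have hr0 : ∀ l, m ≤ l → r l = 0 := by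
      intro l hl
      by_cases h : l = m
      · rw [h, hrm]
      · rw [hr, Finsupp.erase_ne h, hk l (by omega)]
    have hX : isoDiff m (MvPolynomial.monomial k 1) =
        divDiff m (MvPolynomial.monomial (r + Finsupp.single m (a + 1)) 1) := by
      rw [isoDiff_apply, MvPolynomial.X, MvPolynomial.monomial_mul, one_mul, hrk,
        Finsupp.single_add, add_left_comm, add_comm (Finsupp.single m 1)]
    have hshift : k.mapDomain (skip j) =
        Finsupp.single (m + 1) a + r.mapDomain (skip j) := by
      rw [hrk, Finsupp.mapDomain_add, Finsupp.mapDomain_single, skip_of_le (by omega), add_comm]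
    rw [isoChain_succ, ← hm, hX,
      divDiff_monomial_add_single (by rw [hrm, hr0 _ (by omega)]), Finset.sum_range_succ',
      add_comm, map_add]
    refine HasLead.add ?_ fun l hl => ?_
    · have h1 : (MvPolynomial.monomial (r + Finsupp.single m 0 +
          Finsupp.single (m + 1) (a + 1 - 1 - 0)) (1 : ℤ)) =
          MvPolynomial.monomial (Finsupp.single (m + 1) a) 1 * MvPolynomial.monomial r 1 := by
        rw [MvPolynomial.monomial_mul, one_mul, Finsupp.single_zero, add_zero, add_comm]
        rfl
      rw [h1, isoChain_monomial_mul, hshift]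
      · exact (ih r hr0).monomial_mul _
      · intro l hl
        exact Finsupp.single_eq_of_ne (by omega)
    · rw [map_sum] at hl
      obtain ⟨p, hp, hl⟩ := Finset.mem_biUnion.1 (MvPolynomial.support_sum hl)
      rw [Finset.mem_range] at hp
      obtain ⟨k', hk', h1, h2⟩ := exists_of_mem_support_isoChain hl
      have hk'' : k' = r + Finsupp.single m (p + 1) +
          Finsupp.single (m + 1) (a + 1 - 1 - (p + 1)) := by
        simpa using MvPolynomial.support_monomial_subset hk'
      rw [ord_lt_iff, Finsupp.degree_mapDomain]
      refine Or.inr ⟨?_, m + 1, ?_, fun s hs => ?_⟩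
      · rw [h1, hk'', hrk]
        simp only [map_add, Finsupp.degree_single]
        omega
      · rw [h2 _ (by omega), ← skip_of_le (show j ≤ m by omega), mapDomain_skip_apply, hk'',
          skip_of_le (show j ≤ m by omega)]
        simp [hr0 (m + 1) (by omega)]
        omega
      · obtain ⟨s, rfl⟩ : ∃ q, s = q + 1 := ⟨s - 1, by omega⟩
        rw [h2 _ (by omega), ← skip_of_le (show j ≤ s by omega), mapDomain_skip_apply, hk'',
          skip_of_le (show j ≤ s by omega), hk s (by omega)]
        simp [hr0 (s + 1) (by omega), show m ≠ s + 1 by omega, show m ≠ s by omega]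

/-- Each monomial of `f` has its image led by its relabelling, and the relabelling is strictly
monotone, so nothing overtakes the image of the leading term. -/
lemma HasLead.isoChain {f : MvPolynomial ℕ ℤ} {k : ℕ →₀ ℕ} (h : HasLead f k) {j d : ℕ}
    (hf : ∀ k ∈ f.support, ∀ l, j + d ≤ l → k l = 0) :
    HasLead (isoChain j d f) (k.mapDomain (skip j)) := by
  have hk : k ∈ f.support := by
    rw [MvPolynomial.mem_support_iff, h.1]
    exact one_ne_zero
  have hsum : f = MvPolynomial.monomial k 1 +
      ∑ l ∈ f.support.erase k, f.coeff l • MvPolynomial.monomial l 1 := by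
    conv_lhs => rw [f.as_sum, ← Finset.add_sum_erase _ _ hk, h.1]
    congr 1
    refine Finset.sum_congr rfl fun l _ => ?_
    rw [MvPolynomial.smul_monomial, smul_eq_mul, mul_one]
  rw [hsum, map_add]
  refine (hasLead_isoChain_monomial j d k (hf k hk)).add fun l hl => ?_
  rw [map_sum] at hl
  obtain ⟨p, hp, hl⟩ := Finset.mem_biUnion.1 (MvPolynomial.support_sum hl)
  rw [map_smul] at hl
  replace hl := MvPolynomial.support_smul hl
  obtain ⟨hpk, hp⟩ := Finset.mem_erase.1 hp
  have h1 := mapDomain_skip_lt (j := j) (h.2 p hp hpk)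
  by_cases hlp : l = p.mapDomain (skip j)
  · rwa [hlp]
  · exact ((hasLead_isoChain_monomial j d p (hf p hp)).2 l hl hlp).trans h1

/-! ### Insertion of a trivial factor into a normal form -/

/-- The index sequence of `s_j s_{j+1} ⋯ s_N u` when `i` is that of `u ∈ S_N`. -/
def insertCode (N j : ℕ) (i : ℕ → ℕ) : ℕ → ℕ :=
  fun k => if k + 1 < j then i k else if k + 1 = j then j else if k ≤ N then i (k - 1) else k + 1

lemma insertCode_top {N : ℕ} {i : ℕ → ℕ} (hi : IsCode N i) : insertCode N (N + 1) i = i := by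
  funext k
  have := hi.2 k
  unfold insertCode
  split_ifs <;> omega

/-- The empty factor moves down one place by one `step`; starting from `insertCode_top`, every
property of `insertCode` follows by descending induction. -/
lemma insertCode_eq_step {N t : ℕ} (i : ℕ → ℕ) (ht : t + 1 ≤ N) :
    insertCode N (t + 1) i = step (t + 1) (insertCode N (t + 2) i) := by
  funext k
  by_cases h : k = t
  · rw [h, step_pred]
    simp [insertCode]
  by_cases h' : k = t + 1
  · rw [h', step_self]
    simp [insertCode, ht]
  rw [step_of_ne _ h h']
  unfold insertCode
  split_ifs <;> omega

lemma insertCode_lt {N t : ℕ} {i : ℕ → ℕ} (hi : IsCode N i) :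
    insertCode N (t + 2) i t < insertCode N (t + 2) i (t + 1) := by
  have := hi.1 t
  simp [insertCode]
  omega

lemma IsCode.mono {m n : ℕ} {i : ℕ → ℕ} (hi : IsCode m i) (h : m ≤ n) : IsCode n i :=
  ⟨hi.1, fun j hj => hi.2 j (h.trans hj)⟩

lemma IsCode.insertCode {N : ℕ} {i : ℕ → ℕ} (hi : IsCode N i) (d t : ℕ) (h : t + d = N) :
    IsCode (N + 1) (insertCode N (t + 1) i) := by
  induction d generalizing t with
  | zero =>
    obtain rfl : t = N := by omega
    rw [insertCode_top hi]
    exact hi.mono (Nat.le_succ _)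
  | succ d ih =>
    rw [insertCode_eq_step i (by omega)]
    exact (ih (t + 1) (by omega)).step (by omega) (insertCode_lt hi)

lemma IsCode.exists_eq_insertCode {N : ℕ} {i : ℕ → ℕ} (hi : IsCode (N + 1) i) :
    ∃ t ≤ N, ∃ i', IsCode N i' ∧ i = SchubertLead.insertCode N (t + 1) i' := by
  -- The last empty factor; index `0` always qualifies. Beyond it `i k ≤ k`, so shifting those
  -- indices down by one leaves an index sequence.
  set t := Nat.findGreatest (fun t => i t = t + 1) N with ht
  have htN : t ≤ N := Nat.findGreatest_le N
  have hit : i t = t + 1 :=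
    Nat.findGreatest_spec (P := fun t => i t = t + 1) (Nat.zero_le N) hi.zero
  have hgt : ∀ k, t < k → k ≤ N → i k ≠ k + 1 := fun k h1 h2 =>
    Nat.findGreatest_is_greatest (P := fun t => i t = t + 1) h1 h2
  refine ⟨t, htN, fun k => if k < t then i k else if k < N then i (k + 1) else k + 1,
    ⟨fun k => ?_, fun k hk => ?_⟩, ?_⟩
  · have h1 := hi.1 k
    have h2 := hi.1 (k + 1)
    have h3 := hgt (k + 1)
    dsimp only
    split_ifs <;> omega
  · dsimp only
    split_ifs <;> omega
  · funext k
    unfold SchubertLead.insertCode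
    dsimp only
    by_cases h1 : k < t
    · rw [if_pos (by omega), if_pos h1]
    by_cases h2 : k = t
    · rw [if_neg (by omega), if_pos (by omega), h2, hit]
    rw [if_neg (by omega), if_neg (by omega)]
    by_cases h3 : k ≤ N
    · rw [if_pos h3, if_neg (by omega), if_pos (by omega), Nat.sub_add_cancel (by omega)]
    · rw [if_neg h3, hi.2 k (by omega)]

/-- The exponents of `x_1 x_2 ⋯ x_m`. -/
noncomputable def onesExp (m : ℕ) : ℕ →₀ ℕ := ∑ a ∈ Finset.Icc 1 m, Finsupp.single a 1

lemma onesExp_apply (m s : ℕ) : onesExp m s = if 1 ≤ s ∧ s ≤ m then 1 else 0 := by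
  rw [onesExp, Finsupp.finsetSum_apply]
  simp only [Finsupp.single_apply, Finset.sum_ite_eq', Finset.mem_Icc]

lemma onesExp_succ (m : ℕ) : onesExp (m + 1) = onesExp m + Finsupp.single (m + 1) 1 :=
  Finset.sum_Icc_succ_top (by omega) _

lemma imageExp_self {i : ℕ → ℕ} (hi : ∀ j, 1 ≤ i j ∧ i j ≤ j + 1) (q : ℕ) :
    imageExp i q q = onesExp q := by
  rw [imageExp_eq_of_forall_not hi (Nat.zero_le q) fun j _ hj => by omega,
    imageExp_of_le_one (Nat.zero_le 1)]
  rfl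

/-- In the descending step the swap turns `skip (t + 2)` into `skip (t + 1)` and moves the last
variable of `x_1 ⋯ x_{t+1}` to `x_{t+2}`, the one that `codeExp_step` removes. -/
lemma codeExp_insertCode {N : ℕ} {i : ℕ → ℕ} (hi : IsCode N i) (d t : ℕ) (h : t + d = N) :
    codeExp (N + 1) (insertCode N (t + 1) i) =
      onesExp t + (codeExp N i).mapDomain (skip (t + 1)) := by
  induction d generalizing t with
  | zero =>
    obtain rfl : t = N := by omega
    rw [insertCode_top hi, codeExp_succ, hi.2 t le_rfl, Nat.add_sub_cancel, imageExp_self hi.1,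
      mapDomain_skip_eq_self (fun l hl => codeExp_apply_eq_zero hi.1 (by omega)), add_comm]
  | succ d ih =>
    have h1 := codeExp_step (hi.insertCode d (t + 1) (by omega)) (by omega) (insertCode_lt hi)
    rw [← insertCode_eq_step i (by omega), ih (t + 1) (by omega), Finsupp.mapDomain_add,
      ← Finsupp.mapDomain_comp, onesExp_succ, Finsupp.mapDomain_add, Finsupp.mapDomain_single,
      adj_left, mapDomain_adj_eq_self (by simp [onesExp_apply])] at h1
    have h2 : ⇑(adj (t + 1)) ∘ skip (t + 1 + 1) = skip (t + 1) := by
      funext l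
      simp only [Function.comp, adj, Equiv.swap_apply_def, skip]
      split_ifs <;> omega
    rw [h2, add_right_comm] at h1
    exact (add_right_cancel h1).symm

/-- The monomial determines `t`, since `x_{t+1}` is its first absent variable; cancelling `x_1 ⋯
x_t` and the relabelling then leaves the case of `N`. -/
lemma codeExp_injective {n : ℕ} : ∀ i i' : ℕ → ℕ, IsCode n i → IsCode n i' →
    codeExp n i = codeExp n i' → i = i' := by
  induction n with
  | zero =>
    intro i i' hi hi' _
    funext j
    rw [hi.2 j (Nat.zero_le j), hi'.2 j (Nat.zero_le j)]
  | succ N ih =>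
    intro i i' hi hi' h
    obtain ⟨t, ht, c, hc, rfl⟩ := hi.exists_eq_insertCode
    obtain ⟨t', ht', c', hc', rfl⟩ := hi'.exists_eq_insertCode
    rw [codeExp_insertCode hc (N - t) t (by omega),
      codeExp_insertCode hc' (N - t') t' (by omega)] at h
    obtain rfl : t = t' := by
      have h1 := DFunLike.congr_fun h (t + 1)
      have h2 := DFunLike.congr_fun h (t' + 1)
      rw [Finsupp.add_apply, Finsupp.add_apply, mapDomain_skip_self, onesExp_apply,
        onesExp_apply] at h1 h2
      split_ifs at h1 h2 <;> omega
    rw [ih c c' hc hc' (Finsupp.mapDomain_injective (skip_injective _) (add_left_cancel h))]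

lemma exists_codeExp_eq {n : ℕ} : ∀ k ∈ Bx n, ∃ i, IsCode n i ∧ codeExp n i = k := by
  induction n with
  | zero =>
    intro k hk
    refine ⟨fun j => j + 1, ⟨fun j => ⟨Nat.succ_pos j, le_rfl⟩, fun _ _ => rfl⟩, ?_⟩
    ext s
    rw [hk.2 s (by omega)]
    rfl
  | succ N ih =>
    rintro k ⟨hk1, hk2⟩
    have hex : ∃ t, k (t + 1) = 0 := ⟨N, hk2 _ (by omega)⟩
    set t := Nat.find hex with ht
    have ht0 : k (t + 1) = 0 := Nat.find_spec hex
    have htN : t ≤ N := Nat.find_min' hex (hk2 _ (by omega))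
    have hpos : ∀ s, 1 ≤ s → s ≤ t → 1 ≤ k s := by
      intro s h1 h2
      have := Nat.find_min hex (m := s - 1) (by omega)
      rw [Nat.sub_add_cancel h1] at this
      omega
    have hle : onesExp t ≤ k := by
      intro s
      rw [onesExp_apply]
      split_ifs with h
      · exact hpos s h.1 h.2
      · exact Nat.zero_le _
    clear_value t
    clear ht hex
    obtain ⟨r, rfl⟩ := exists_add_of_le hle
    have hr : r (t + 1) = 0 := by
      rw [Finsupp.add_apply] at ht0
      omega
    obtain ⟨c, rfl⟩ : ∃ c, r = Finsupp.mapDomain (skip (t + 1)) c := by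
      refine ⟨r.comapDomain (skip (t + 1)) (skip_injective _).injOn,
        (Finsupp.mapDomain_comapDomain _ (skip_injective _) r fun s hs => ?_).symm⟩
      refine exists_skip_eq fun h => ?_
      rw [h] at hs
      exact Finsupp.mem_support_iff.1 hs hr
    -- Up to `t` the exponent has dropped by one, beyond `t` the index has; either way the bound `N
    -- + 1` on their sum becomes `N`.
    have hc : c ∈ Bx N := by
      have hval : ∀ s, (onesExp t + c.mapDomain (skip (t + 1))) (skip (t + 1) s) =
          onesExp t (skip (t + 1) s) + c s := by
        intro s
        rw [Finsupp.add_apply, mapDomain_skip_apply]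
      constructor
      · intro s hs
        have h1 := hval s
        have h2 := hk1 (skip (t + 1) s)
        rw [h1, onesExp_apply] at h2
        unfold skip at h2
        split_ifs at h2 <;> omega
      · intro s hs
        have h1 := hval s
        have h2 := hk1 (skip (t + 1) s)
        have h3 := hk2 (skip (t + 1) s)
        rw [h1, onesExp_apply] at h2 h3
        unfold skip at h2 h3
        split_ifs at h2 h3 <;> omega
    obtain ⟨i, hi, rfl⟩ := ih c hc
    exact ⟨insertCode N (t + 1) i, hi.insertCode (N - t) t (by omega),
      codeExp_insertCode hi (N - t) t (by omega)⟩

/-! ### Schubert polynomials -/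

/-- The exponents of `x_1^{n-1} x_2^{n-2} ⋯ x_{n-1}`. -/
noncomputable def stairExp (n : ℕ) : ℕ →₀ ℕ :=
  ∑ k ∈ Finset.Icc 1 (n - 1), Finsupp.single k (n - k)

lemma stairExp_apply (n s : ℕ) : stairExp n s = if 1 ≤ s then n - s else 0 := by
  rw [stairExp, Finsupp.finsetSum_apply]
  simp only [Finsupp.single_apply, Finset.sum_ite_eq', Finset.mem_Icc]
  split_ifs <;> omega

lemma prod_X_pow_eq_monomial (n : ℕ) :
    (∏ k ∈ Finset.Icc 1 (n - 1), MvPolynomial.X k ^ (n - k) : MvPolynomial ℕ ℤ) =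
      MvPolynomial.monomial (stairExp n) 1 := by
  rw [stairExp, MvPolynomial.monomial_sum_one]
  simp only [MvPolynomial.X_pow_eq_monomial]

lemma divDiffWord_mul_left {w : List ℕ} {g : MvPolynomial ℕ ℤ} (h : ∀ t ∈ w, swapVars t g = g)
    (f : MvPolynomial ℕ ℤ) : divDiffWord w (g * f) = g * divDiffWord w f := by
  induction w with
  | nil => rfl
  | cons t w ih =>
    have := ih fun s hs => h s (List.mem_cons_of_mem _ hs)
    change divDiff t (divDiffWord w (g * f)) = g * divDiff t (divDiffWord w f)
    rw [this, divDiff_mul_left (h t List.mem_cons_self)]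

/-- The polynomial `∂_u (x_1^{n-1} ⋯ x_{n-1})` for the element `u` with index sequence `i`. -/
noncomputable def codePoly (n : ℕ) (i : ℕ → ℕ) : MvPolynomial ℕ ℤ :=
  divDiffWord (codeWord n i) (MvPolynomial.monomial (stairExp n) 1)

/-- The staircase monomial gains the factor `x_1 ⋯ x_N`, which is symmetric for all letters of
`S_N`. -/
lemma codePoly_succ {N : ℕ} {i : ℕ → ℕ} (hi : IsCode N i) :
    codePoly (N + 1) i = MvPolynomial.monomial (onesExp N) 1 * codePoly N i := by
  have h1 : stairExp (N + 1) = onesExp N + stairExp N := by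
    ext s
    rw [Finsupp.add_apply, stairExp_apply, stairExp_apply, onesExp_apply]
    split_ifs <;> omega
  have h2 : (MvPolynomial.monomial (stairExp (N + 1)) (1 : ℤ)) =
      MvPolynomial.monomial (onesExp N) 1 * MvPolynomial.monomial (stairExp N) 1 := by
    rw [MvPolynomial.monomial_mul, one_mul, h1]
  rw [codePoly, codeWord_succ_of_code hi.zero.ge, hi.2 N le_rfl, desc_of_lt (Nat.lt_succ_self N),
    List.append_nil, h2, divDiffWord_mul_left, codePoly]
  intro t ht
  have := isWord_codeWord hi.1 t ht
  apply swapVars_monomial_of_eq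
  rw [onesExp_apply, onesExp_apply, if_pos (by omega), if_pos (by omega)]

lemma codePoly_step {n t : ℕ} {i : ℕ → ℕ} (hi : IsCode n i) (ht : t + 1 < n)
    (h : i t < i (t + 1)) : codePoly n (step (t + 1) i) = divDiff (t + 1) (codePoly n i) :=
  divDiffWord_step hi ht h _

/-- The isobaric operators arise from `∂_{t+1} (x_1 ⋯ x_{t+1} g) = x_1 ⋯ x_t · π_{t+1} g`. -/
lemma codePoly_insertCode {N : ℕ} {i : ℕ → ℕ} (hi : IsCode N i) (d t : ℕ) (h : t + d = N) :
    codePoly (N + 1) (insertCode N (t + 1) i) =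
      MvPolynomial.monomial (onesExp t) 1 * isoChain (t + 1) d (codePoly N i) := by
  induction d generalizing t with
  | zero =>
    obtain rfl : t = N := by omega
    rw [insertCode_top hi, codePoly_succ hi]
    rfl
  | succ d ih =>
    have h1 : (MvPolynomial.monomial (onesExp (t + 1)) (1 : ℤ)) =
        MvPolynomial.monomial (onesExp t) 1 * MvPolynomial.X (t + 1) := by
      rw [MvPolynomial.X, MvPolynomial.monomial_mul, one_mul, onesExp_succ]
    rw [insertCode_eq_step i (by omega),
      codePoly_step (hi.insertCode d (t + 1) (by omega)) (by omega) (insertCode_lt hi),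
      ih (t + 1) (by omega), h1, mul_assoc,
      divDiff_mul_left (swapVars_monomial_of_eq (by simp [onesExp_apply])), ← isoDiff_apply,
      isoChain_succ_left]

/-- `∂_t` keeps the exponents within `B_x`: the new ones at `t` and `t + 1` lie strictly below the
old maximum, which is at most `n - t`. -/
lemma mem_Bx_of_mem_support {n : ℕ} {w : List ℕ} (hw : IsWord n w) {l : ℕ →₀ ℕ}
    (hl : l ∈ (divDiffWord w (MvPolynomial.monomial (stairExp n) (1 : ℤ))).support) :
    l ∈ Bx n := by
  induction w generalizing l with
  | nil =>
    have : l = stairExp n := by simpa using MvPolynomial.support_monomial_subset hl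
    rw [this]
    constructor
    · intro s hs
      rw [stairExp_apply]
      split_ifs <;> omega
    · intro s hs
      rw [stairExp_apply]
      split_ifs <;> omega
  | cons t w ih =>
    obtain ⟨k, hk, -, h1, h2, h3⟩ := exists_divDiffRel_of_mem_support hl
    have hkB := ih (fun s hs => hw s (List.mem_cons_of_mem _ hs)) hk
    have ht := hw t List.mem_cons_self
    have k1 := hkB.1 t ht
    have k2 := hkB.1 (t + 1)
    have k3 := hkB.2 (t + 1)
    constructor
    · intro s hs
      by_cases hst : s = t
      · rw [hst]
        omega
      by_cases hst' : s = t + 1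
      · rw [hst'] at hs ⊢
        omega
      rw [h1 s hst hst']
      exact hkB.1 s hs
    · intro s hs
      by_cases hst : s = t
      · omega
      by_cases hst' : s = t + 1
      · rw [hst'] at hs ⊢
        omega
      rw [h1 s hst hst']
      exact hkB.2 s hs

lemma codePoly_support {n : ℕ} {i : ℕ → ℕ} (hi : IsCode n i) {l : ℕ →₀ ℕ}
    (hl : l ∈ (codePoly n i).support) : l ∈ Bx n :=
  mem_Bx_of_mem_support (isWord_codeWord hi.1) hl

lemma hasLead_codePoly {n : ℕ} : ∀ i, IsCode n i → HasLead (codePoly n i) (codeExp n i) := by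
  induction n with
  | zero =>
    intro i _
    have : codePoly 0 i = MvPolynomial.monomial (codeExp 0 i) 1 := rfl
    rw [this]
    exact hasLead_monomial _
  | succ N ih =>
    intro i hi
    obtain ⟨t, ht, c, hc, rfl⟩ := hi.exists_eq_insertCode
    rw [codePoly_insertCode hc (N - t) t (by omega), codeExp_insertCode hc (N - t) t (by omega)]
    refine HasLead.monomial_mul ((ih c hc).isoChain fun k hk l hl => ?_) _
    exact (codePoly_support hc hk).2 l (by omega)

lemma codeExp_mem_Bx {n : ℕ} {i : ℕ → ℕ} (hi : IsCode n i) : codeExp n i ∈ Bx n := by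
  apply codePoly_support hi
  rw [MvPolynomial.mem_support_iff, (hasLead_codePoly i hi).1]
  exact one_ne_zero

lemma schubert_w0 (n : ℕ) : schubert (w0 n) = MvPolynomial.monomial (stairExp n) 1 := by
  have h1 : IsCode n (fun j => j + 1) := ⟨fun j => ⟨Nat.succ_pos j, le_rfl⟩, fun j _ => rfl⟩
  have hnil : codeWord n (fun j => j + 1) = [] := by
    simp [codeWord, desc_of_lt]
  rw [schubert, prod_X_pow_eq_monomial, inv_mul_cancel, divDiffPerm, normalWord,
    code_eq h1 (by rw [hnil]; rfl), hnil]
  rfl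

lemma divDiffPerm_schubert_w0 {n : ℕ} (u : SymGroup n) :
    divDiffPerm u (schubert (w0 n)) = codePoly n (code u) := by
  rw [schubert_w0]
  rfl

lemma prodX_eq_codeExp {n : ℕ} (u : SymGroup n) : prodX u = codeExp n (code u) :=
  sum_monX_eq_codeExp (code_spec u).1.1

lemma code_injective {n : ℕ} : Function.Injective (code : SymGroup n → ℕ → ℕ) := by
  intro u v h
  apply Subtype.ext
  rw [← (code_spec u).2, ← (code_spec v).2, h]

lemma code_adj_mul {n t : ℕ} (u : SymGroup n) (ht : 1 ≤ t + 1 ∧ t + 1 ≤ n - 1)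
    (h : code u t < code u (t + 1)) :
    code (⟨adj (t + 1), adj_mem ht⟩ * u : SymGroup n) = step (t + 1) (code u) := by
  have hi := (code_spec u).1
  apply code_eq (hi.step (by omega) h)
  rw [wordProd_step hi (by omega) h, (code_spec u).2]
  rfl

end SchubertLead

/-! ### Assembly of the theorem -/

theorem theorem3p1 (n : ℕ) (hn : 2 ≤ n) :
    -- Part (i)
    ((∀ u : SymGroup n,
        divDiffPerm u (schubert (w0 n)) ∈ MvPolynomial.supported ℤ (Set.Icc 1 (n - 1)) ∧
        ord.Monic (divDiffPerm u (schubert (w0 n))) ∧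
        lm (divDiffPerm u (schubert (w0 n))) = prodX u) ∧
      Set.BijOn (fun u : SymGroup n => prodX u) Set.univ (Bx n) ∧
      (∀ u v : SymGroup n, u ≠ v →
        lm (divDiffPerm u (schubert (w0 n))) ≠ lm (divDiffPerm v (schubert (w0 n))))) ∧
    -- Part (ii); `t :: normalWord u` is the word `s_t u`, and
    -- `⟨adj t, adj_mem ht⟩ * u` is the permutation `s_t u` in `S_n`
    (∀ (u : SymGroup n) (t : ℕ) (ht : 1 ≤ t ∧ t ≤ n - 1),
      (IsReducedWord n (t :: normalWord u) ↔
        lm (divDiffPerm u (schubert (w0 n))) (t + 1) <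
          lm (divDiffPerm u (schubert (w0 n))) t) ∧
      (lm (divDiffPerm u (schubert (w0 n))) (t + 1) <
          lm (divDiffPerm u (schubert (w0 n))) t →
        divDiff t (MvPolynomial.monomial (lm (divDiffPerm u (schubert (w0 n)))) 1) ≠ 0 ∧
        divDiffPerm (⟨adj t, adj_mem ht⟩ * u : SymGroup n) (schubert (w0 n)) =
          divDiffWord (t :: normalWord u) (schubert (w0 n)) ∧
        lm (divDiffPerm (⟨adj t, adj_mem ht⟩ * u : SymGroup n) (schubert (w0 n))) =
          lm (divDiff t
            (MvPolynomial.monomial (lm (divDiffPerm u (schubert (w0 n)))) 1)))) := by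
  have hlm : ∀ u : SymGroup n, lm (divDiffPerm u (schubert (w0 n))) = codeExp n (code u) :=
    fun u => by
      rw [divDiffPerm_schubert_w0]
      exact (hasLead_codePoly _ (code_spec u).1).lm_eq
  have hinj : ∀ u v : SymGroup n, codeExp n (code u) = codeExp n (code v) → u = v :=
    fun u v h => code_injective (codeExp_injective _ _ (code_spec u).1 (code_spec v).1 h)
  refine ⟨⟨fun u => ⟨?_, ?_, ?_⟩, ⟨?_, ?_, ?_⟩, fun u v huv h => ?_⟩, fun u t ht => ?_⟩
  · rw [MvPolynomial.mem_supported, divDiffPerm_schubert_w0]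
    intro s hs
    obtain ⟨l, hl, hls⟩ := (MvPolynomial.mem_vars_iff_mem_support s).1 hs
    by_contra hne
    exact Finsupp.mem_support_iff.1 hls
      ((codePoly_support (code_spec u).1 hl).2 s fun h => hne (Set.mem_Icc.2 h))
  · rw [divDiffPerm_schubert_w0]
    exact (hasLead_codePoly _ (code_spec u).1).monic
  · rw [hlm, prodX_eq_codeExp]
  · intro u _
    change prodX u ∈ Bx n
    rw [prodX_eq_codeExp]
    exact codeExp_mem_Bx (code_spec u).1
  · intro u _ v _ h
    change prodX u = prodX v at h
    rw [prodX_eq_codeExp, prodX_eq_codeExp] at h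
    exact hinj u v h
  · intro k hk
    obtain ⟨i, hi, rfl⟩ := exists_codeExp_eq k hk
    refine ⟨⟨wordProd (codeWord n i), wordProd_mem (isWord_codeWord hi.1)⟩, Set.mem_univ _, ?_⟩
    change prodX _ = _
    rw [prodX_eq_codeExp, code_eq hi rfl]
  · rw [hlm, hlm] at h
    exact huv (hinj u v h)
  · obtain ⟨t, rfl⟩ : ∃ s, t = s + 1 := ⟨t - 1, by omega⟩
    have htn : t + 1 < n := by omega
    have hi := (code_spec u).1
    have hiff := codeExp_lt_iff hi htn
    rw [hlm]
    refine ⟨(isReducedWord_cons_iff hi htn).trans hiff.symm, fun hlt => ?_⟩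
    have hcode := hiff.1 hlt
    -- The leading exponents of `∂_t` applied to the leading monomial are those of `s_t u`, so
    -- non-vanishing and the last equality both follow.
    have hlead := hasLead_divDiff_monomial hlt (codeExp_step hi htn hcode)
    refine ⟨hlead.monic.ne_zero, ?_, ?_⟩
    · rw [divDiffPerm_schubert_w0, code_adj_mul u ht hcode, codePoly_step hi htn hcode,
        ← divDiffPerm_schubert_w0]
      rfl
    · rw [hlm, code_adj_mul u ht hcode, hlead.lm_eq]
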